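/- **Model.** A network is a finite simple undirected graph $G$ with $n=|V(G)|$. Each vertex has a unique identifier of $\lceil\log_2 n\rceil$ bits and initially knows $r$, $n$, its own identifier and the identifiers of its neighbors. In the $\mathsf{CONGEST}_{\mathrm{BC}}$ model, computation is synchronous: in each round every vertex broadcasts one message of $O(\log n)$ bits to all of its neighbors, receives the messages of its neighbors, and performs arbitrary local computation. The complexity is the number of rounds. **Notions.** A graph $H$ is a depth-$r$ minor of $G$ if there are pairwise disjoint connected subgraphs $B_x\subseteq G$ $(x\in V(H))$ of radius at most $r$ such that for every edge $xy$ of $H$ some edge of $G$ joins $B_x$ to $B_y$. A class $\mathcal C$ of finite graphs has bounded expansion if there is $g:\mathbb N\to\mathbb N$ such that for all $r$, every depth-$r$ minor of every $G\in\mathcal C$ has average degree at most $g(r)$. For a linear order $L$ of $V(G)$, $\mathrm{WReach}_k[G,L,v]$ is the set of vertices $u$ for which there is a path of length at most $k$ between $u$ and $v$ on which $u$ is the $L$-minimum. An $r$-neighborhood cover of $G$ is a set $\mathcal X$ of subsets of $V(G)$ (clusters) such that every closed ball $N_r[v]$ is contained in some $X\in\mathcal X$. It has radius at most $d$ if every $G[X]$,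 $X\in\mathcal X$, is connected of radius at most $d$, and degree at most $c$ if every vertex lies in at most $c$ clusters. **Theorem.** Let $\mathcal C$ be a class of graphs of bounded expansion. There are a deterministic distributed algorithm, constants $K,c\in\mathbb N$ and functions $b,f:\mathbb N\to\mathbb N$, all depending only on $\mathcal C$, such that for every $r\in\mathbb N$, every $G\in\mathcal C$ with $n=|V(G)|$, and every assignment of identifiers, the algorithm terminates after at most $K\,r^2\lceil\log_2 n\rceil$ rounds, every message that it broadcasts has at most $b(r)\lceil\log_2 n\rceil$ bits (so it is a $\mathsf{CONGEST}_{\mathrm{BC}}$ algorithm with $O(r^2\log n)$ rounds), and its outputs represent an $r$-neighborhood cover of $G$ of radius at most $2r$ and degree at most $f(r)$, in the following sense. There is a linear order $L$ of $V(G)$ such that 1. every vertex outputs a label, a number of at most $c\lceil\log_2 n\rceil$ bits, and $u\le_L v$ if and only if the label of $u$ is at most the label of $v$; 2. every vertex $v$ outputs, for each $u\in\mathrm{WReach}_{2r}[G,L,v]$ and for no other vertex, the identifier of $u$ together with exactly one path from $v$ to $u$ (as a list of identifiers), which has length at most $2r$ and stays inside the cluster $X_u=\{w\in V(G): u\in\mathrm{WReach}_{2r}[G,L,w]\}$;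 3. $\mathcal X=\{X_u: u\in V(G)\}$ is an $r$-neighborhood cover of $G$ of radius at most $2r$ and degree at most $f(r)$. -/

import Mathlib

universe u

namespace SparseCover

/-! ### Graph classes of bounded expansion -/

/-- A class of graphs. Only its finite members are ever considered. -/
abbrev GraphClass := ∀ ⦃V : Type u⦄, SimpleGraph V → Prop

/-- `H` is a depth-`r` minor of `G`: there are pairwise disjoint subgraphs (branch sets) of `G`,
one for each vertex of `H`, each connected and of radius at most `r`, such that adjacent vertices
of `H` have branch sets joined by an edge of `G`. -/
def IsDepthMinor {W V : Type u} (r : ℕ) (H : SimpleGraph W) (G : SimpleGraph V) : Prop :=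
  ∃ B : W → G.Subgraph,
    (∀ i j, i ≠ j → Disjoint (B i).verts (B j).verts) ∧
    (∀ i, (B i).coe.Connected ∧ (B i).coe.radius ≤ (r : ℕ∞)) ∧
    (∀ i j, H.Adj i j → ∃ x ∈ (B i).verts, ∃ y ∈ (B j).verts, G.Adj x y)

/-- The average degree `2|E(H)| / |V(H)|` of a finite graph (`0` for the graph without vertices). -/
noncomputable def averageDegree {W : Type u} [Fintype W] (H : SimpleGraph W) : ℚ :=
  2 * (H.edgeSet.ncard : ℚ) / (Fintype.card W : ℚ)

/-- Bounded expansion: the average degree of every depth-`r` minor of every member of the class is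
at most `f r`, for some function `f`. -/
def BoundedExpansion (𝒞 : GraphClass.{u}) : Prop :=
  ∃ f : ℕ → ℕ, ∀ (r : ℕ) (V : Type u) [Fintype V] (G : SimpleGraph V), 𝒞 G →
    ∀ (W : Type u) [Fintype W] (H : SimpleGraph W),
      IsDepthMinor r H G → averageDegree H ≤ (f r : ℚ)

/-! ### Weak reachability and neighborhood covers -/

/-- `WReach_k[G, L, v]`: the vertices `u` for which there is a path of length at most `k` between
`v` and `u` on which `u` is the `L`-minimum. -/
def wReach {V : Type u} (G : SimpleGraph V) (L : LinearOrder V) (k : ℕ) (v : V) : Set V :=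
  {u | ∃ p : G.Walk v u, p.IsPath ∧ p.length ≤ k ∧ ∀ x ∈ p.support, L.le u x}

/-- The cluster `X_u` of all `w` such that `u ∈ WReach_{2r}[G, L, w]`. -/
def cluster {V : Type u} (G : SimpleGraph V) (L : LinearOrder V) (r : ℕ) (u : V) : Set V :=
  {w | u ∈ wReach G L (2 * r) w}

/-- The closed neighborhood `N_r[v]`. -/
def closedNeighborhood {V : Type u} (G : SimpleGraph V) (r : ℕ) (v : V) : Set V :=
  {u | G.edist v u ≤ (r : ℕ∞)}

/-- `𝒳` is an `r`-neighborhood cover of `G`. -/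
def IsNeighborhoodCover {V : Type u} (G : SimpleGraph V) (r : ℕ) (𝒳 : Set (Set V)) : Prop :=
  ∀ v, ∃ X ∈ 𝒳, closedNeighborhood G r v ⊆ X

/-- Every cluster of `𝒳` induces a connected graph of radius at most `d`. -/
def CoverRadiusAtMost {V : Type u} (G : SimpleGraph V) (𝒳 : Set (Set V)) (d : ℕ) : Prop :=
  ∀ X ∈ 𝒳, (G.induce X).Connected ∧ (G.induce X).radius ≤ (d : ℕ∞)

/-- Every vertex lies in at most `c` clusters of `𝒳`. -/
def CoverDegreeAtMost {V : Type u} (𝒳 : Set (Set V)) (c : ℕ) : Prop :=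
  ∀ v, {X ∈ 𝒳 | v ∈ X}.encard ≤ (c : ℕ∞)

/-! ### The broadcast model -/

/-- What a vertex knows before the first round: the parameter `r`, the order of the network,
its own identifier, and the identifiers of its neighbors. -/
structure LocalInput where
  param : ℕ
  order : ℕ
  ownId : ℕ
  nbrIds : Finset ℕ

/-- A deterministic synchronous broadcast algorithm. All vertices run the same program. In each
round a vertex broadcasts one bit string, computed from its state, to all its neighbors, and
updates its state from the messages received, each tagged with the identifier of its sender.
There is no restriction on local computations. As all vertices know `r` and the order `n` of the
network, they stop together, after `rounds r n` rounds, and then give their outputs. -/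
structure BroadcastAlgorithm (Output : Type) where
  State : Type
  init : LocalInput → State
  send : State → List Bool
  receive : State → Finset (ℕ × List Bool) → State
  output : State → Output
  rounds : ℕ → ℕ → ℕ

/-- The vertices have pairwise distinct identifiers of `⌈log₂ n⌉` bits, where `n = |V|`. -/
def IsIdAssignment {V : Type u} [Fintype V] (ident : V → ℕ) : Prop :=
  Function.Injective ident ∧ ∀ v, ident v < 2 ^ Nat.clog 2 (Fintype.card V)

namespace BroadcastAlgorithm

variable {Output : Type} (A : BroadcastAlgorithm Output)

open Classical in
/-- The state of every vertex after `t` rounds on the network `G` with parameter `r`. -/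
noncomputable def stateAfter {V : Type u} [Fintype V] (G : SimpleGraph V) (ident : V → ℕ)
    (r : ℕ) : ℕ → V → A.State
  | 0 => fun v => A.init
      { param := r
        order := Fintype.card V
        ownId := ident v
        nbrIds := (G.neighborFinset v).image ident }
  | t + 1 => fun v => A.receive (stateAfter G ident r t v)
      ((G.neighborFinset v).image fun w => (ident w, A.send (stateAfter G ident r t w)))

/-- The output of a vertex on termination. -/
noncomputable def result {V : Type u} [Fintype V] (G : SimpleGraph V) (ident : V → ℕ)
    (r : ℕ) (v : V) : Output :=
  A.output (A.stateAfter G ident r (A.rounds r (Fintype.card V)) v)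

/-- No message broadcast during the execution is longer than `b` bits. -/
def MessagesAtMost {V : Type u} [Fintype V] (G : SimpleGraph V) (ident : V → ℕ)
    (r b : ℕ) : Prop :=
  ∀ t < A.rounds r (Fintype.card V), ∀ v : V,
    (A.send (A.stateAfter G ident r t v)).length ≤ b

end BroadcastAlgorithm

/-! ### Representations of covers -/

/-- The output of a single vertex: its label, and a finite routing table whose entries consist of
the identifier of a target and the list of identifiers along a path to that target. -/
structure CoverOutput where
  label : ℕ
  routes : Finset (ℕ × List ℕ)

/-- The labels represent `L`: they are numbers of at most `b` bits whose order is `L`. -/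
def LabelsRepresent {V : Type u} (out : V → CoverOutput) (L : LinearOrder V) (b : ℕ) : Prop :=
  (∀ v, (out v).label < 2 ^ b) ∧ ∀ u v, L.le u v ↔ (out u).label ≤ (out v).label

/-- The routing table of every vertex `v` has exactly one entry for every
`u ∈ WReach_{2r}[G, L, v]` and no other entries, and the entry of `u` is a path of length
at most `2r` from `v` to `u` inside the cluster of `u`. -/
def RoutesCorrect {V : Type u} (G : SimpleGraph V) (ident : V → ℕ) (L : LinearOrder V) (r : ℕ)
    (out : V → CoverOutput) : Prop :=
  ∀ v,
    (∀ u ∈ wReach G L (2 * r) v, ∃! l : List ℕ, (ident u, l) ∈ (out v).routes) ∧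
    (∀ e ∈ (out v).routes, ∃ u ∈ wReach G L (2 * r) v, ∃ p : G.Walk v u,
      p.IsPath ∧ p.length ≤ 2 * r ∧ (∀ x ∈ p.support, x ∈ cluster G L r u) ∧
      e = (ident u, p.support.map ident))

end SparseCover

namespace SparseCover

open Finset

/-! The `L`-minimum of a ball `N_r[v]` is weakly `2r`-reachable from every vertex of the ball, so
for any order `L` the clusters form a cover of radius at most `2r`, whose degree is bounded by the
sizes of the sets `WReach_{2r}`. What remains is to find, within the round and message bounds, an
order for which these sets are bounded.

The order comes from peeling, with `k = 2r`. Given the set `S` of remaining vertices, a phase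
removes those that, for every `d < k`, reach few vertices of `S` (their exits) by walks of length at
most `d + 1` with interior outside `S`. Vertices peeled later are smaller in `L`; ties are broken by
identifiers. If `u` is weakly reachable from `v`, then `u` was still present when `v` was peeled, so
the witnessing path meets the set remaining at that time in one of the few exits of `v`. Recursion
on the length bounds the weakly reachable vertices (`card_layerReach_le`).

Each phase removes at least half of `S` (`two_mul_card_remaining_succ_le`). A vertex outside `S` was
peeled earlier, so it hits only boundedly many, say `F`, vertices of `S` (`card_hits_remaining_le`).
Choose `A ⊆ S` at random and let a vertex outside `S` join the cell of `v` when `v` is its unique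
nearest vertex of `A`. Contracting the cells gives a shallow minor, which has `O(|S|)` edges, while
a pair of a vertex and one of its other exits becomes adjacent with probability at least `2^(-F)`.
Hence the average number of exits is bounded (`sum_card_exits_le`), and Markov's inequality applies.

All of this is local: hits are found by flooding for `2r` rounds per phase, and `2⌈log₂ n⌉` phases
are followed by `2r` rounds that build the routing tables. The same bounds limit the size of every
set broadcast. -/

theorem connected_and_radius_le {V : Type u} (G : SimpleGraph V) (c : V) (d : ℕ)
    (h : ∀ v, ∃ p : G.Walk v c, p.length ≤ d) : G.Connected ∧ G.radius ≤ (d : ℕ∞) := by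
  have : Nonempty V := ⟨c⟩
  refine ⟨SimpleGraph.Connected.mk fun x y => ?_,
    le_trans (show G.radius ≤ G.eccent c from iInf_le _ c) ?_⟩
  · obtain ⟨p, -⟩ := h x
    obtain ⟨q, -⟩ := h y
    exact ⟨p.append q.reverse⟩
  · rw [SimpleGraph.eccent_le_iff]
    intro v
    obtain ⟨p, hp⟩ := h v
    rw [SimpleGraph.edist_comm]
    exact p.edist_le.trans (by exact_mod_cast hp)

/-! ### The first vertices of a set on walks -/

open Classical in
/-- The vertices of `S` at which a walk of length at most `d` starting in `x` can meet `S`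
for the first time. -/
noncomputable def hits {V : Type u} [Fintype V] (G : SimpleGraph V) (S : Finset V) :
    ℕ → V → Finset V
  | 0, x => if x ∈ S then {x} else ∅
  | d + 1, x => if x ∈ S then {x} else (G.neighborFinset x).biUnion (hits G S d)

open Classical in
/-- The vertices of `S` at which a walk of length at most `d + 1` starting in `x` can meet `S`
for the first time after its start. -/
noncomputable def exits {V : Type u} [Fintype V] (G : SimpleGraph V) (S : Finset V)
    (d : ℕ) (x : V) : Finset V :=
  (G.neighborFinset x).biUnion (hits G S d)

section Hits

variable {V : Type u} [Fintype V] {G : SimpleGraph V} {S : Finset V} {d e : ℕ} {u v x y : V}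

theorem mem_exits : u ∈ exits G S d x ↔ ∃ y, G.Adj x y ∧ u ∈ hits G S d y := by
  simp [exits]

theorem hits_of_mem (hx : x ∈ S) (d : ℕ) : hits G S d x = {x} := by
  cases d <;> simp [hits, hx]

theorem hits_zero_of_notMem (hx : x ∉ S) : hits G S 0 x = ∅ := by
  simp [hits, hx]

theorem hits_succ_of_notMem (hx : x ∉ S) (d : ℕ) : hits G S (d + 1) x = exits G S d x := by
  simp [hits, exits, hx]

theorem mem_of_mem_hits (h : u ∈ hits G S d x) : u ∈ S := by
  induction d generalizing x with
  | zero =>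
    by_cases hx : x ∈ S
    · rw [hits_of_mem hx, mem_singleton] at h
      exact h ▸ hx
    · simp [hits_zero_of_notMem hx] at h
  | succ d ih =>
    by_cases hx : x ∈ S
    · rw [hits_of_mem hx, mem_singleton] at h
      exact h ▸ hx
    · rw [hits_succ_of_notMem hx, mem_exits] at h
      obtain ⟨y, -, hy⟩ := h
      exact ih hy

theorem mem_of_mem_exits (h : u ∈ exits G S d x) : u ∈ S := by
  obtain ⟨y, -, hy⟩ := mem_exits.1 h
  exact mem_of_mem_hits hy

theorem hits_subset_succ : hits G S d x ⊆ hits G S (d + 1) x := by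
  induction d generalizing x with
  | zero =>
    by_cases hx : x ∈ S
    · simp [hits_of_mem hx]
    · simp [hits_zero_of_notMem hx]
  | succ d ih =>
    by_cases hx : x ∈ S
    · simp [hits_of_mem hx]
    · intro u hu
      rw [hits_succ_of_notMem hx, mem_exits] at hu ⊢
      obtain ⟨y, hxy, hy⟩ := hu
      exact ⟨y, hxy, ih hy⟩

theorem hits_mono (h : d ≤ e) : hits G S d x ⊆ hits G S e x := by
  induction h with
  | refl => exact Subset.refl _
  | step _ ih => exact ih.trans hits_subset_succ

/-- If a walk outside `S` ends in `u`, and `v` is hit from its start, then `v` is hit from its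
last vertex outside `S`. -/
theorem exists_adj_mem_hits (hu : u ∈ hits G S d y) (hy : y ∉ S) (hv : v ∈ hits G S (e + 1) y) :
    ∃ x, x ∉ S ∧ G.Adj x u ∧ v ∈ hits G S (e + d) x := by
  induction d generalizing y e with
  | zero => simp [hits_zero_of_notMem hy] at hu
  | succ d ih =>
    rw [hits_succ_of_notMem hy, mem_exits] at hu
    obtain ⟨z, hyz, hz⟩ := hu
    by_cases hzS : z ∈ S
    · rw [hits_of_mem hzS, mem_singleton] at hz
      subst hz
      exact ⟨y, hy, hyz, hits_mono (by omega) hv⟩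
    -- Moving the start from `y` to `z` brings it one step closer to `u` and adds one step to the
    -- way back to `v`.
    · have hv' : v ∈ hits G S (e + 1 + 1) z := by
        rw [hits_succ_of_notMem hzS, mem_exits]
        exact ⟨y, hyz.symm, hv⟩
      obtain ⟨x, hx, hxu, hvx⟩ := ih hz hzS hv'
      exact ⟨x, hx, hxu, hits_mono (by omega) hvx⟩

/-- Read the walk backwards from its last vertex `x` outside `S`; without the edge to `u` its length
is at most `d`. This trades the exits of `v`, which are to be counted, for the hits of a vertex
outside `S`, which are already bounded. -/
theorem exists_adj_of_mem_exits (hv : v ∈ S) (hu : u ∈ exits G S d v) :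
    G.Adj v u ∨ ∃ x, x ∉ S ∧ G.Adj x u ∧ v ∈ hits G S d x := by
  obtain ⟨y, hvy, hy⟩ := mem_exits.1 hu
  by_cases hyS : y ∈ S
  · rw [hits_of_mem hyS, mem_singleton] at hy
    subst hy
    exact Or.inl hvy
  · right
    have hv' : v ∈ hits G S (0 + 1) y := by
      rw [hits_succ_of_notMem hyS, mem_exits]
      exact ⟨v, hvy.symm, by simp [hits_of_mem hv]⟩
    obtain ⟨x, hx, hxu, hvx⟩ := exists_adj_mem_hits hy hyS hv'
    exact ⟨x, hx, hxu, hits_mono (by omega) hvx⟩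

/-- First hits of a set are reached by way of first hits of a larger set. -/
theorem exists_mem_hits_of_subset {S' : Finset V} (hS : S ⊆ S') (hu : u ∈ hits G S d x) :
    ∃ y ∈ hits G S' d x, u ∈ hits G S d y := by
  induction d generalizing x with
  | zero =>
    by_cases hx : x ∈ S
    · exact ⟨x, by simp [hits_of_mem (hS hx)], hu⟩
    · simp [hits_zero_of_notMem hx] at hu
  | succ d ih =>
    by_cases hx' : x ∈ S'
    · exact ⟨x, by simp [hits_of_mem hx'], hu⟩
    · have hx : x ∉ S := fun h => hx' (hS h)
      rw [hits_succ_of_notMem hx, mem_exits] at hu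
      obtain ⟨z, hxz, hz⟩ := hu
      obtain ⟨y, hy, huy⟩ := ih hz
      refine ⟨y, ?_, hits_subset_succ huy⟩
      rw [hits_succ_of_notMem hx', mem_exits]
      exact ⟨z, hxz, hy⟩

/-- Splitting off the first step makes the walk advance even if `x ∈ S'`, the case needed for the
recursion of `hitBound`. -/
theorem exists_mem_exits_of_subset {S' : Finset V} (hS : S ⊆ S') (hx : x ∉ S)
    (hu : u ∈ hits G S (d + 1) x) : ∃ y ∈ exits G S' d x, u ∈ hits G S d y := by
  rw [hits_succ_of_notMem hx, mem_exits] at hu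
  obtain ⟨z, hxz, hz⟩ := hu
  obtain ⟨y, hy, huy⟩ := exists_mem_hits_of_subset hS hz
  exact ⟨y, mem_exits.2 ⟨z, hxz, hy⟩, huy⟩

end Hits

/-! ### Shallow minors given by subsets -/

section Cells

variable {V : Type u} [Fintype V] (G : SimpleGraph V) (S : Finset V) (d : ℕ)

open Classical in
/-- The vertex `v` together with all vertices `x` outside `S` such that `v` is the nearest
vertex of `A` seen from `x`, and there is no other one at the same distance. -/
def hitCell (A : Finset V) (v : V) : Set V :=
  {x | x = v ∨ x ∉ S ∧ ∃ e ≤ d, A ∩ hits G S e x = {v}}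

variable {G S d} {A : Finset V} {v w x : V}

/-- Hits grow with the distance, so of two singletons seen from `x` at different distances one
contains the other. -/
theorem eq_of_mem_hitCell (hv : v ∈ S) (hw : w ∈ S) (hxv : x ∈ hitCell G S d A v)
    (hxw : x ∈ hitCell G S d A w) : v = w := by
  classical
  rcases hxv with rfl | ⟨hx, e, -, he⟩
  · rcases hxw with rfl | ⟨hx', -⟩
    · rfl
    · exact absurd hv hx'
  · rcases hxw with rfl | ⟨-, f, -, hf⟩
    · exact absurd hw hx
    · rcases le_total e f with hef | hef
      · have : v ∈ A ∩ hits G S f x :=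
          inter_subset_inter_left (hits_mono hef) (he ▸ mem_singleton_self v)
        rw [hf] at this
        exact mem_singleton.1 this
      · have : w ∈ A ∩ hits G S e x :=
          inter_subset_inter_left (hits_mono hef) (hf ▸ mem_singleton_self w)
        rw [he] at this
        exact (mem_singleton.1 this).symm

/-- A walk from `x` to its first hit `v` never leaves the cell: what the next vertex sees within `e`
steps, `x` sees within `e + 1`, so no second vertex of `A` can appear. -/
theorem exists_walk_hitCell (x : ((⊤ : G.Subgraph).induce (hitCell G S d A v)).verts) :
    ∃ p : ((⊤ : G.Subgraph).induce (hitCell G S d A v)).coe.Walk x ⟨v, Or.inl rfl⟩,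
      p.length ≤ d := by
  classical
  have key : ∀ e ≤ d, ∀ (x : V) (hx : x ∉ S) (hxv : x ∈ hitCell G S d A v),
      A ∩ hits G S e x = {v} →
      ∃ p : ((⊤ : G.Subgraph).induce (hitCell G S d A v)).coe.Walk ⟨x, hxv⟩ ⟨v, Or.inl rfl⟩,
        p.length ≤ e := by
    intro e
    induction e with
    | zero =>
      intro _ x hx _ h
      simp [hits_zero_of_notMem hx] at h
    | succ e ih =>
      intro hed x hx hxv h
      have hv : v ∈ A ∩ hits G S (e + 1) x := h ▸ mem_singleton_self v
      obtain ⟨hvA, hvx⟩ := mem_inter.1 hv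
      rw [hits_succ_of_notMem hx, mem_exits] at hvx
      obtain ⟨y, hxy, hy⟩ := hvx
      by_cases hyS : y ∈ S
      · rw [hits_of_mem hyS, mem_singleton] at hy
        subst hy
        have hadj : ((⊤ : G.Subgraph).induce (hitCell G S d A v)).coe.Adj ⟨x, hxv⟩
          ⟨v, Or.inl rfl⟩ := ⟨hxv, Or.inl rfl, hxy⟩
        exact ⟨SimpleGraph.Walk.cons hadj .nil,
          Nat.succ_le_succ (Nat.zero_le e)⟩
      · have hye : A ∩ hits G S e y = {v} := by
          apply Subset.antisymm
          · rw [← h]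
            intro z hz
            rw [mem_inter] at hz ⊢
            refine ⟨hz.1, ?_⟩
            rw [hits_succ_of_notMem hx, mem_exits]
            exact ⟨y, hxy, hz.2⟩
          · simpa using ⟨hvA, hy⟩
        have hyv : y ∈ hitCell G S d A v := Or.inr ⟨hyS, e, by omega, hye⟩
        obtain ⟨p, hp⟩ := ih (by omega) y hyS hyv hye
        have hadj : ((⊤ : G.Subgraph).induce (hitCell G S d A v)).coe.Adj ⟨x, hxv⟩ ⟨y, hyv⟩ :=
          ⟨hxv, hyv, hxy⟩
        exact ⟨SimpleGraph.Walk.cons hadj p,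
          Nat.succ_le_succ hp⟩
  obtain ⟨x, hx⟩ := x
  rcases id hx with rfl | ⟨hxS, e, he, h⟩
  · exact ⟨.nil, by simp⟩
  · obtain ⟨p, hp⟩ := key e he x hxS hx h
    exact ⟨p, hp.trans he⟩

variable (G S d A)

/-- The minor obtained by contracting the cells of the vertices of `S`. -/
def hitMinor : SimpleGraph S where
  Adj v w := v ≠ w ∧ ∃ x ∈ hitCell G S d A v, ∃ y ∈ hitCell G S d A w, G.Adj x y
  symm := ⟨fun _ _ ⟨h, x, hx, y, hy, hxy⟩ => ⟨h.symm, y, hy, x, hx, hxy.symm⟩⟩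
  loopless := ⟨fun _ h => h.1 rfl⟩

theorem isDepthMinor_hitMinor : IsDepthMinor d (hitMinor G S d A) G := by
  refine ⟨fun v => (⊤ : G.Subgraph).induce (hitCell G S d A v), fun v w hvw => ?_, fun v => ?_,
    fun v w h => h.2⟩
  · rw [Set.disjoint_left]
    intro x hxv hxw
    exact hvw (Subtype.ext (eq_of_mem_hitCell v.2 w.2 hxv hxw))
  · exact connected_and_radius_le _ _ d exists_walk_hitCell

end Cells

/-! ### Counting -/

open Classical in
theorem card_adj_pairs_le {W : Type u} [Fintype W] (H : SimpleGraph W) {g : ℕ}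
    (h : averageDegree H ≤ g) :
    (univ.filter fun p : W × W => H.Adj p.1 p.2).card ≤ g * Fintype.card W := by
  have h1 : (univ.filter fun p : W × W => H.Adj p.1 p.2).card = 2 * H.edgeSet.ncard := by
    have : H.edgeSet.ncard = H.edgeFinset.card := by
      rw [← SimpleGraph.coe_edgeFinset, Set.ncard_coe_finset]
    rw [this, ← SimpleGraph.sum_degrees_eq_twice_card_edges, card_filter,
      ← univ_product_univ, sum_product]
    refine sum_congr rfl fun v _ => ?_
    rw [← card_filter, ← SimpleGraph.card_neighborFinset_eq_degree]
    congr 1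
    ext w
    simp
  rw [h1]
  rcases Nat.eq_zero_or_pos (Fintype.card W) with h0 | h0
  · have := Fintype.card_eq_zero_iff.1 h0
    have h2 : H.edgeSet = ∅ := by
      ext e
      induction e with | _ a b => exact isEmptyElim a
    simp [h2]
  · rw [averageDegree, div_le_iff₀ (by exact_mod_cast h0)] at h
    exact_mod_cast h

open Classical in
-- A uniformly random `A ⊆ S` meets `N` in exactly `v` with probability `2^(-|N|)`. Adjoining `v` to
-- the subsets of `S \ N` gives the needed lower bound.
theorem two_pow_le_card_filter_inter {V : Type u} {S N : Finset V} {v : V} (hN : N ⊆ S)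
    (hv : v ∈ N) : 2 ^ S.card ≤ 2 ^ N.card * (S.powerset.filter fun A => A ∩ N = {v}).card := by
  have h1 : (S \ N).powerset.card ≤ (S.powerset.filter fun A => A ∩ N = {v}).card := by
    refine card_le_card_of_injOn (insert v) (fun B hB => ?_) (fun B hB C hC h => ?_)
    · have hB' : B ⊆ S \ N := mem_powerset.1 hB
      simp only [coe_filter, mem_powerset, Set.mem_ofPred_eq]
      refine ⟨insert_subset (hN hv) (hB'.trans sdiff_subset), ?_⟩
      rw [insert_inter_of_mem hv]
      have : B ∩ N = ∅ := by
        rw [← disjoint_iff_inter_eq_empty]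
        exact disjoint_of_subset_left hB' sdiff_disjoint
      simp [this]
    · have hB' : v ∉ B := fun h => (mem_sdiff.1 ((mem_powerset.1 hB) h)).2 hv
      have hC' : v ∉ C := fun h => (mem_sdiff.1 ((mem_powerset.1 hC) h)).2 hv
      rw [← erase_insert hB', ← erase_insert hC']
      exact congrArg (fun X => X.erase v) h
  calc 2 ^ S.card = 2 ^ N.card * (S \ N).powerset.card := by
        rw [card_powerset, ← pow_add, card_sdiff_of_subset hN,
          Nat.add_sub_cancel' (card_le_card hN)]
    _ ≤ _ := Nat.mul_le_mul_left _ h1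

/-- On average, few vertices of `S` can be reached from a vertex of `S` by short walks outside
`S`, provided that few vertices of `S` can be reached from vertices outside `S`. -/
theorem sum_card_exits_le {V : Type u} [Fintype V] (G : SimpleGraph V) (S : Finset V)
    {d F g : ℕ} (hF : ∀ x ∉ S, (hits G S d x).card ≤ F)
    (hg : ∀ (W : Type u) [Fintype W] (H : SimpleGraph W), IsDepthMinor d H G →
      averageDegree H ≤ g) :
    ∑ v ∈ S, (exits G S d v).card ≤ S.card * (1 + g * 2 ^ F) := by
  classical
  -- A vertex can be an exit of itself; dropping these pairs costs the summand `1` in the bound.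
  let P : Finset (Σ _ : V, V) := S.sigma fun v => (exits G S d v).erase v
  -- Incidences between sets `A` and pairs `p` are counted twice: for fixed `A` by the density of
  -- the minor (`hA`), for fixed `p` by the probability of being joined (`hp`).
  let r : Finset V → (Σ _ : V, V) → Prop := fun A p =>
    ∃ x ∈ hitCell G S d A p.1, ∃ y ∈ hitCell G S d A p.2, G.Adj x y
  have hP : ∑ v ∈ S, (exits G S d v).card ≤ S.card + P.card := by
    rw [card_sigma, card_eq_sum_ones, ← sum_add_distrib]
    refine sum_le_sum fun v _ => ?_
    have := pred_card_le_card_erase (s := exits G S d v) (a := v)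
    omega
  have hA : ∀ A ∈ S.powerset, (P.bipartiteAbove r A).card ≤ g * S.card := by
    intro A _
    refine le_trans ?_ ((card_adj_pairs_le _ (hg _ _ (isDepthMinor_hitMinor G S d A))).trans_eq
      (by simp))
    rw [← card_map ⟨fun q : S × S => (⟨q.1, q.2⟩ : Σ _ : V, V), fun a b h => by
      simp only [Sigma.mk.injEq, heq_eq_eq] at h
      exact Prod.ext (Subtype.ext h.1) (Subtype.ext h.2)⟩]
    refine card_le_card fun p hp => ?_
    rw [mem_bipartiteAbove, mem_sigma, mem_erase] at hp
    obtain ⟨⟨h1, h2, h3⟩, h4⟩ := hp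
    rw [mem_map]
    refine ⟨(⟨p.1, h1⟩, ⟨p.2, mem_of_mem_exits h3⟩), ?_, rfl⟩
    simp only [mem_filter, mem_univ, true_and]
    exact ⟨fun h => h2 (congrArg Subtype.val h).symm, h4⟩
  have hp : ∀ p ∈ P, 2 ^ S.card ≤ 2 ^ F * (S.powerset.bipartiteBelow r p).card := by
    intro p hp
    rw [mem_sigma, mem_erase] at hp
    obtain ⟨h1, h2, h3⟩ := hp
    -- An edge of `G` joins the two cells for every `A`. Otherwise it suffices that `A` meets the
    -- hits of `x` in `v` alone, since `x` then lies in the cell of `v`.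
    rcases exists_adj_of_mem_exits h1 h3 with h4 | ⟨x, hx, hxu, hvx⟩
    · have : S.powerset.bipartiteBelow r p = S.powerset := by
        apply filter_true_of_mem
        intro A _
        exact ⟨p.1, Or.inl rfl, p.2, Or.inl rfl, h4⟩
      rw [this, card_powerset]
      exact Nat.le_mul_of_pos_left _ (by positivity)
    · have hsub : hits G S d x ⊆ S := fun z hz => mem_of_mem_hits hz
      refine (two_pow_le_card_filter_inter hsub hvx).trans ?_
      refine Nat.mul_le_mul (Nat.pow_le_pow_right (by norm_num) (hF x hx)) (card_le_card ?_)
      intro A hA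
      rw [mem_filter] at hA
      rw [mem_bipartiteBelow]
      exact ⟨hA.1, x, Or.inr ⟨hx, d, le_rfl, hA.2⟩, p.2, Or.inl rfl, hxu⟩
  have hdc := sum_card_bipartiteAbove_eq_sum_card_bipartiteBelow (s := S.powerset) (t := P) r
  have h1 : P.card * 2 ^ S.card ≤ 2 ^ F * (2 ^ S.card * (g * S.card)) := by
    calc P.card * 2 ^ S.card = ∑ p ∈ P, 2 ^ S.card := by simp
      _ ≤ ∑ p ∈ P, 2 ^ F * (S.powerset.bipartiteBelow r p).card := sum_le_sum hp
      _ = 2 ^ F * ∑ A ∈ S.powerset, (P.bipartiteAbove r A).card := by rw [hdc, mul_sum]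
      _ ≤ 2 ^ F * ∑ A ∈ S.powerset, g * S.card := Nat.mul_le_mul_left _ (sum_le_sum hA)
      _ = _ := by simp
  have h2 : P.card ≤ 2 ^ F * (g * S.card) := by
    refine Nat.le_of_mul_le_mul_right (c := 2 ^ S.card) ?_ (by positivity)
    calc _ ≤ _ := h1
      _ = _ := by ring
  calc _ ≤ _ := hP
    _ ≤ S.card + 2 ^ F * (g * S.card) := by omega
    _ = _ := by ring

/-! ### Peeling -/

section Bounds

variable (g : ℕ → ℕ) (k : ℕ)

/-- A bound on the number of vertices hit by walks of length at most `d`. -/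
def hitBound : ℕ → ℕ
  | 0 => 1
  | d + 1 => 2 * k * (1 + g d * 2 ^ hitBound d) * hitBound d

/-- The number of exits by walks of length at most `d + 1` up to which a vertex may be peeled. -/
def exitBound (d : ℕ) : ℕ := 2 * k * (1 + g d * 2 ^ hitBound g k d)

/-- A bound on the number of weakly reachable vertices. -/
def reachBound : ℕ → ℕ
  | 0 => 1
  | e + 1 => 1 + exitBound g k e * reachBound e

variable {g k}

theorem hitBound_pos (hk : 0 < k) (d : ℕ) : 0 < hitBound g k d := by
  induction d with
  | zero => exact Nat.one_pos
  | succ d ih => rw [hitBound]; positivity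

theorem exitBound_pos (hk : 0 < k) (d : ℕ) : 0 < exitBound g k d := by
  rw [exitBound]; positivity

theorem hitBound_mono (hk : 0 < k) {d e : ℕ} (h : d ≤ e) : hitBound g k d ≤ hitBound g k e := by
  induction h with
  | refl => exact le_rfl
  -- The recursion of `hitBound` multiplies by `exitBound g k d`, up to unfolding.
  | step _ ih => exact ih.trans (Nat.le_mul_of_pos_left _ (exitBound_pos hk _))

theorem reachBound_pos (e : ℕ) : 0 < reachBound g k e := by
  cases e with
  | zero => exact Nat.one_pos
  | succ e => rw [reachBound]; positivity

theorem reachBound_mono (hk : 0 < k) {d e : ℕ} (h : d ≤ e) :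
    reachBound g k d ≤ reachBound g k e := by
  induction h with
  | refl => exact le_rfl
  | step _ ih =>
    refine ih.trans ?_
    rw [reachBound]
    have := Nat.le_mul_of_pos_left (reachBound g k ‹_›) (exitBound_pos (g := g) hk ‹_›)
    omega

end Bounds

variable {V : Type u} [Fintype V] (G : SimpleGraph V) (g : ℕ → ℕ) (k : ℕ)

open Classical in
/-- The vertices that remain after `p` phases of peeling; a vertex remains as long as it has too
many exits. -/
noncomputable def remaining : ℕ → Finset V
  | 0 => univ
  | p + 1 => (remaining p).filter fun v =>
      ∃ d < k, exitBound g k d < (exits G (remaining p) d v).card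

open Classical in
/-- The number of phases, among the first `p`, that `v` survives. -/
noncomputable def layer : ℕ → V → ℕ
  | 0, _ => 0
  | p + 1, v => if v ∈ remaining G g k (p + 1) then p + 1 else layer p v

variable {G g k} {p i d e : ℕ} {u v x : V}

theorem remaining_succ_subset : remaining G g k (p + 1) ⊆ remaining G g k p := by
  classical
  rw [remaining]
  exact filter_subset _ _

theorem remaining_antitone : Antitone (remaining G g k) :=
  antitone_nat_of_succ_le fun _ => remaining_succ_subset

theorem layer_le : layer G g k p v ≤ p := by
  induction p with
  | zero => simp [layer]
  | succ p ih =>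
    rw [layer]
    split_ifs <;> omega

theorem mem_remaining_iff_le_layer (h : i ≤ p) :
    v ∈ remaining G g k i ↔ i ≤ layer G g k p v := by
  induction p with
  | zero =>
    obtain rfl : i = 0 := by omega
    simp [remaining]
  | succ p ih =>
    rw [layer]
    split_ifs with hv
    · exact ⟨fun _ => h, fun _ => remaining_antitone h hv⟩
    · rcases Nat.lt_or_ge p i with hi | hi
      · obtain rfl : i = p + 1 := by omega
        have := layer_le (G := G) (g := g) (k := k) (p := p) (v := v)
        exact ⟨fun h => absurd h hv, fun h => by omega⟩
      · exact ih hi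

theorem mem_remaining_iff_layer_eq : v ∈ remaining G g k p ↔ layer G g k p v = p := by
  rw [mem_remaining_iff_le_layer le_rfl]
  have := layer_le (G := G) (g := g) (k := k) (p := p) (v := v)
  omega

theorem card_exits_le_of_peeled (hv : v ∈ remaining G g k p) (hv' : v ∉ remaining G g k (p + 1))
    (hd : d < k) : (exits G (remaining G g k p) d v).card ≤ exitBound g k d := by
  classical
  rw [remaining, mem_filter] at hv'
  by_contra! h
  exact hv' ⟨hv, d, hd, h⟩

/-- If `x` is no longer present, it had few exits in the phase that peeled it, and each of its walks
to the current, smaller set passes through one of them. Apply the induction hypothesis from there.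
-/
theorem card_hits_remaining_le (hd : d ≤ k) :
    (hits G (remaining G g k p) d x).card ≤ hitBound g k d := by
  classical
  induction d generalizing x with
  | zero =>
    by_cases hx : x ∈ remaining G g k p
    · simp [hits_of_mem hx, hitBound]
    · simp [hits_zero_of_notMem hx]
  | succ d ih =>
    by_cases hx : x ∈ remaining G g k p
    · rw [hits_of_mem hx, card_singleton]
      exact hitBound_pos (by omega) _
    · have hi : x ∈ remaining G g k (layer G g k p x) :=
        (mem_remaining_iff_le_layer layer_le).2 le_rfl
      have hlt : layer G g k p x < p :=
        lt_of_le_of_ne layer_le fun h => hx (mem_remaining_iff_layer_eq.2 h)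
      have hi' : x ∉ remaining G g k (layer G g k p x + 1) := by
        rw [mem_remaining_iff_le_layer hlt]
        omega
      have hsub : hits G (remaining G g k p) (d + 1) x ⊆
          (exits G (remaining G g k (layer G g k p x)) d x).biUnion
            (hits G (remaining G g k p) d) := by
        intro u hu
        obtain ⟨y, hy, huy⟩ := exists_mem_exits_of_subset
          (remaining_antitone (layer_le (p := p) (v := x))) hx hu
        exact mem_biUnion.2 ⟨y, hy, huy⟩
      calc _ ≤ _ := card_le_card hsub
        _ ≤ _ := card_biUnion_le_card_mul _ _ _ fun y _ => ih (by omega)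
        _ ≤ _ := Nat.mul_le_mul_right _ (card_exits_le_of_peeled hi hi' (by omega))

/-- Every phase peels at least half of the remaining vertices. -/
theorem two_mul_card_remaining_succ_le (hk : 0 < k)
    (hg : ∀ (d : ℕ) (W : Type u) [Fintype W] (H : SimpleGraph W), IsDepthMinor d H G →
      averageDegree H ≤ g d) :
    2 * (remaining G g k (p + 1)).card ≤ (remaining G g k p).card := by
  classical
  set S := remaining G g k p with hS
  let bad : ℕ → Finset V := fun d => S.filter fun v => exitBound g k d < (exits G S d v).card
  -- Markov's inequality: `exitBound` is `2k` times the bound on the average, so each of the `k`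
  -- distances spoils at most a fraction `1/(2k)` of `S`, together at most half.
  have hbad : ∀ d ∈ range k, (bad d).card * (2 * k) ≤ S.card := by
    intro d hd
    have hpos : 0 < 1 + g d * 2 ^ hitBound g k d := by positivity
    refine Nat.le_of_mul_le_mul_right ?_ hpos
    calc (bad d).card * (2 * k) * (1 + g d * 2 ^ hitBound g k d)
        = (bad d).card * exitBound g k d := by rw [exitBound]; ring
      _ = ∑ v ∈ bad d, exitBound g k d := by simp
      _ ≤ ∑ v ∈ bad d, (exits G S d v).card := sum_le_sum fun v hv => (mem_filter.1 hv).2.le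
      _ ≤ ∑ v ∈ S, (exits G S d v).card :=
        sum_le_sum_of_subset (filter_subset _ _)
      _ ≤ _ := sum_card_exits_le G S
        (fun x _ => card_hits_remaining_le (mem_range.1 hd).le) (hg d)
  have hsub : remaining G g k (p + 1) ⊆ (range k).biUnion bad := by
    intro v hv
    rw [remaining, mem_filter] at hv
    obtain ⟨hv, d, hd, h⟩ := hv
    exact mem_biUnion.2 ⟨d, mem_range.2 hd, mem_filter.2 ⟨hv, h⟩⟩
  have h1 : (remaining G g k (p + 1)).card * (2 * k) ≤ k * S.card := by
    calc _ ≤ (∑ d ∈ range k, (bad d).card) * (2 * k) :=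
          Nat.mul_le_mul_right _ ((card_le_card hsub).trans card_biUnion_le)
      _ = ∑ d ∈ range k, (bad d).card * (2 * k) := sum_mul _ _ _
      _ ≤ ∑ d ∈ range k, S.card := sum_le_sum hbad
      _ = _ := by simp
  refine Nat.le_of_mul_le_mul_left ?_ hk
  calc _ = (remaining G g k (p + 1)).card * (2 * k) := by ring
    _ ≤ _ := h1

theorem remaining_eq_empty (hk : 0 < k)
    (hg : ∀ (d : ℕ) (W : Type u) [Fintype W] (H : SimpleGraph W), IsDepthMinor d H G →
      averageDegree H ≤ g d) (hp : Fintype.card V < 2 ^ p) : remaining G g k p = ∅ := by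
  have key : ∀ q, (remaining G g k q).card * 2 ^ q ≤ Fintype.card V := by
    intro q
    induction q with
    | zero => simp [remaining]
    | succ q ih =>
      calc (remaining G g k (q + 1)).card * 2 ^ (q + 1)
          = 2 * (remaining G g k (q + 1)).card * 2 ^ q := by ring
        _ ≤ _ := (Nat.mul_le_mul_right _ (two_mul_card_remaining_succ_le hk hg)).trans ih
  rw [← card_eq_zero]
  by_contra h
  have := Nat.le_mul_of_pos_left (2 ^ p) (Nat.pos_of_ne_zero h)
  have := key p
  omega

/-! ### Weak reachability by layers -/

theorem exists_mem_hits_of_walk {S : Finset V} (q : G.Walk x u) (hq : q.length ≤ e)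
    (hu : u ∈ S) : ∃ y ∈ hits G S e x, ∃ q' : G.Walk y u, q'.length ≤ e ∧
      ∀ z ∈ q'.support, z ∈ q.support := by
  induction q generalizing e with
  | nil => exact ⟨_, by simp [hits_of_mem hu], .nil, by simp, fun z hz => hz⟩
  | @cons a b c h q ih =>
    by_cases ha : a ∈ S
    · exact ⟨a, by simp [hits_of_mem ha], .cons h q, hq, fun z hz => hz⟩
    · rw [SimpleGraph.Walk.length_cons] at hq
      obtain ⟨e, rfl⟩ : ∃ e', e = e' + 1 := ⟨e - 1, by omega⟩
      obtain ⟨y, hy, q', hq', hs⟩ := ih (e := e) (by omega) hu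
      refine ⟨y, ?_, q', by omega, fun z hz => by simp [hs z hz]⟩
      rw [hits_succ_of_notMem ha, mem_exits]
      exact ⟨b, h, hy⟩

open Classical in
/-- The vertices of maximal layer on some walk of length at most `e` from `v`. -/
noncomputable def layerReach (G : SimpleGraph V) (l : V → ℕ) (e : ℕ) (v : V) : Finset V :=
  univ.filter fun u => ∃ q : G.Walk v u, q.length ≤ e ∧ ∀ x ∈ q.support, l x ≤ l u

/-- A vertex `u` of maximal layer on a walk from `v` still belongs to the set `S` from which `v` is
peeled. The first return `y` of the walk to `S` is an exit of `v`, and the tail shows that `u` is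
reached from `y` in the same sense. -/
theorem card_layerReach_le (hp : remaining G g k p = ∅) (he : e ≤ k) :
    (layerReach G (layer G g k p) e v).card ≤ reachBound g k e := by
  classical
  induction e generalizing v with
  | zero =>
    refine card_le_one.2 fun a ha b hb => ?_
    simp only [layerReach, mem_filter, mem_univ, true_and, nonpos_iff_eq_zero] at ha hb
    obtain ⟨q, hq, -⟩ := ha
    obtain ⟨q', hq', -⟩ := hb
    rw [← SimpleGraph.Walk.eq_of_length_eq_zero hq, SimpleGraph.Walk.eq_of_length_eq_zero hq']
  | succ e ih =>
    set l := layer G g k p with hl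
    set S := remaining G g k (l v) with hS
    have hv : v ∈ S := (mem_remaining_iff_le_layer layer_le).2 le_rfl
    have hlt : l v < p := lt_of_le_of_ne layer_le fun h => by
      have := mem_remaining_iff_layer_eq.2 h
      simp [hp] at this
    have hv' : v ∉ remaining G g k (l v + 1) := by
      rw [mem_remaining_iff_le_layer hlt]
      exact Nat.not_succ_le_self _
    have hsub : layerReach G l (e + 1) v ⊆
        insert v ((exits G S e v).biUnion (layerReach G l e)) := by
      intro u hu
      simp only [layerReach, mem_filter, mem_univ, true_and] at hu
      obtain ⟨q, hq, hs⟩ := hu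
      cases q with
      | nil => exact mem_insert_self _ _
      | @cons _ z _ h q =>
        have huS : u ∈ S := (mem_remaining_iff_le_layer layer_le).2 (hs v (by simp))
        rw [SimpleGraph.Walk.length_cons] at hq
        obtain ⟨y, hy, q', hq', hs'⟩ := exists_mem_hits_of_walk q (by omega : q.length ≤ e) huS
        refine mem_insert_of_mem (mem_biUnion.2 ⟨y, mem_exits.2 ⟨z, h, hy⟩, ?_⟩)
        simp only [layerReach, mem_filter, mem_univ, true_and]
        exact ⟨q', hq', fun x hx => hs x (by simp [hs' x hx])⟩
    calc _ ≤ _ := card_le_card hsub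
      _ ≤ _ := card_insert_le _ _
      _ ≤ exitBound g k e * reachBound g k e + 1 := by
        refine Nat.add_le_add_right ?_ 1
        refine (card_biUnion_le_card_mul _ _ _ fun y _ => ih (by omega)).trans ?_
        exact Nat.mul_le_mul_right _ (card_exits_le_of_peeled hv hv' (by omega))
      _ = _ := by rw [reachBound, Nat.add_comm]

/-! ### Covers by weak reachability -/

section Covers

variable {V : Type u} {G : SimpleGraph V} {L : LinearOrder V} {k r : ℕ} {u v x : V}

theorem mem_wReach_of_walk (p : G.Walk v u) (hp : p.length ≤ k)
    (h : ∀ x ∈ p.support, L.le u x) : u ∈ wReach G L k v := by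
  classical
  exact ⟨p.bypass, p.bypass_isPath, p.length_bypass_le_length.trans hp,
    fun x hx => h x (p.support_bypass_subset_support hx)⟩

theorem mem_wReach_of_mem_support (p : G.Walk v u) (hp : p.length ≤ k)
    (h : ∀ x ∈ p.support, L.le u x) (hx : x ∈ p.support) : u ∈ wReach G L k x := by
  classical
  exact mem_wReach_of_walk (p.dropUntil x hx) ((p.length_dropUntil_le_length hx).trans hp)
    fun y hy => h y (p.support_dropUntil_subset_support hx hy)

theorem mem_wReach_zero : u ∈ wReach G L 0 v ↔ u = v := by
  constructor
  · rintro ⟨p, -, hp, -⟩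
    exact (SimpleGraph.Walk.eq_of_length_eq_zero (Nat.le_zero.1 hp)).symm
  · rintro rfl
    exact mem_wReach_of_walk .nil le_rfl fun x hx => by
      rw [SimpleGraph.Walk.support_nil, List.mem_singleton] at hx
      exact hx ▸ L.le_refl _

theorem wReach_mono {k' : ℕ} (h : k ≤ k') : wReach G L k v ⊆ wReach G L k' v :=
  fun _ ⟨p, hp, hl, hs⟩ => ⟨p, hp, hl.trans h, hs⟩

theorem wReach_eq_of_subsingleton [Subsingleton V] {L : LinearOrder V} (d e : ℕ) (v : V) :
    wReach G L d v = wReach G L e v := by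
  ext u
  obtain rfl := Subsingleton.elim u v
  exact ⟨fun _ => wReach_mono (Nat.zero_le _) (mem_wReach_zero.2 rfl),
    fun _ => wReach_mono (Nat.zero_le _) (mem_wReach_zero.2 rfl)⟩

/-- The minimum `u` of the ball serves: shortest paths from `w` to `v` and from `v` to `u` stay in
the ball and have total length at most `2r`. -/
theorem isNeighborhoodCover_cluster [Finite V] :
    IsNeighborhoodCover G r (Set.range (cluster G L r)) := by
  classical
  intro v
  obtain ⟨u, hu, hmin⟩ := @Set.exists_min_image V V L (closedNeighborhood G r v) id
    (Set.toFinite _) ⟨v, by simp [closedNeighborhood]⟩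
  refine ⟨_, ⟨u, rfl⟩, fun w hw => ?_⟩
  have hwalk : ∀ w ∈ closedNeighborhood G r v, ∃ p : G.Walk v w, p.length ≤ r ∧
      ∀ x ∈ p.support, x ∈ closedNeighborhood G r v := by
    intro w hw
    have hr : G.Reachable v w := SimpleGraph.edist_ne_top_iff_reachable.1
      (ne_top_of_le_ne_top (ENat.natCast_ne_top r) hw)
    obtain ⟨p, hp⟩ := hr.exists_walk_length_eq_edist
    have hpr : p.length ≤ r := by exact_mod_cast hp.trans_le hw
    refine ⟨p, hpr, fun x hx => ?_⟩
    exact (p.takeUntil x hx).edist_le.trans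
      (by exact_mod_cast (p.length_takeUntil_le_length hx).trans hpr)
  obtain ⟨p, hp, hps⟩ := hwalk u hu
  obtain ⟨q, hq, hqs⟩ := hwalk w hw
  refine mem_wReach_of_walk (q.reverse.append p) ?_ fun x hx => ?_
  · rw [SimpleGraph.Walk.length_append, SimpleGraph.Walk.length_reverse]
    omega
  · rw [SimpleGraph.Walk.mem_support_append_iff, SimpleGraph.Walk.support_reverse,
      List.mem_reverse] at hx
    exact hmin x (hx.elim (hqs x) (hps x))

theorem coverRadiusAtMost_cluster :
    CoverRadiusAtMost G (Set.range (cluster G L r)) (2 * r) := by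
  rintro _ ⟨u, rfl⟩
  have hu : u ∈ cluster G L r u := wReach_mono (Nat.zero_le _) (mem_wReach_zero.2 rfl)
  refine connected_and_radius_le _ ⟨u, hu⟩ (2 * r) fun ⟨w, hw⟩ => ?_
  obtain ⟨p, -, hl, hs⟩ := hw
  have hp : ∀ x ∈ p.support, x ∈ cluster G L r u := fun x hx =>
    mem_wReach_of_mem_support p hl hs hx
  refine ⟨p.induce _ hp, ?_⟩
  rwa [← SimpleGraph.Walk.length_map (SimpleGraph.Embedding.induce _).toHom,
    SimpleGraph.Walk.map_induce]

theorem coverDegreeAtMost_cluster {c : ℕ} (h : ∀ v, (wReach G L (2 * r) v).encard ≤ c) :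
    CoverDegreeAtMost (Set.range (cluster G L r)) c := by
  intro v
  have hsub : {X ∈ Set.range (cluster G L r) | v ∈ X} ⊆
      cluster G L r '' wReach G L (2 * r) v := by
    rintro _ ⟨⟨u, rfl⟩, hv⟩
    exact ⟨u, hv, rfl⟩
  exact (Set.encard_le_encard hsub).trans ((Set.encard_image_le _ _).trans (h v))

end Covers

/-! ### Bit strings -/

section Codes

variable {α : Type*}

/-- The binary representation with `w` bits. -/
def natCode (w x : ℕ) : List Bool := List.ofFn fun i : Fin w => x.testBit i

/-- The code of an optional element whose code has `B` bits. -/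
def optionCode (B : ℕ) (c : α → List Bool) : Option α → List Bool
  | none => List.replicate (B + 1) false
  | some x => true :: c x

/-- The code of a list with at most `m` elements whose codes have `B` bits. -/
def listCode (B : ℕ) (c : α → List Bool) (m : ℕ) (l : List α) : List Bool :=
  (List.ofFn fun i : Fin m => optionCode B c l[(i : ℕ)]?).flatten

theorem length_natCode (w x : ℕ) : (natCode w x).length = w := by
  simp [natCode]

theorem natCode_inj {w x y : ℕ} (hx : x < 2 ^ w) (hy : y < 2 ^ w)
    (h : natCode w x = natCode w y) : x = y := by
  refine Nat.eq_of_testBit_eq fun i => ?_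
  rcases Nat.lt_or_ge i w with hi | hi
  · exact congrFun (List.ofFn_injective h) ⟨i, hi⟩
  · rw [Nat.testBit_lt_two_pow (hx.trans_le (Nat.pow_le_pow_right (by norm_num) hi)),
      Nat.testBit_lt_two_pow (hy.trans_le (Nat.pow_le_pow_right (by norm_num) hi))]

variable {B m : ℕ} {c : α → List Bool} {p : α → Prop}

theorem length_optionCode (hB : ∀ x, p x → (c x).length = B) {o : Option α}
    (ho : ∀ x ∈ o, p x) : (optionCode B c o).length = B + 1 := by
  cases o with
  | none => simp [optionCode]
  | some x => simp [optionCode, hB x (ho x rfl)]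

theorem optionCode_inj (hc : ∀ x y, p x → p y → c x = c y → x = y) {o o' : Option α}
    (ho : ∀ x ∈ o, p x) (ho' : ∀ x ∈ o', p x) (h : optionCode B c o = optionCode B c o') :
    o = o' := by
  cases o with
  | none =>
    cases o' with
    | none => rfl
    | some y => simp [optionCode, List.replicate_succ] at h
  | some x =>
    cases o' with
    | none => simp [optionCode, List.replicate_succ] at h
    | some y =>
      rw [hc x y (ho x rfl) (ho' y rfl) (List.cons.inj h).2]

theorem map_length_optionCode (hB : ∀ x, p x → (c x).length = B) {l : List α}
    (hl : ∀ x ∈ l, p x) :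
    (List.ofFn fun i : Fin m => optionCode B c l[(i : ℕ)]?).map List.length =
      List.replicate m (B + 1) := by
  rw [List.map_ofFn, ← List.ofFn_const]
  congr 1
  funext i
  exact length_optionCode hB fun x hx => hl x (List.mem_of_getElem? hx)

theorem length_listCode (hB : ∀ x, p x → (c x).length = B) {l : List α} (hl : ∀ x ∈ l, p x) :
    (listCode B c m l).length = m * (B + 1) := by
  rw [listCode, List.length_flatten, map_length_optionCode hB hl, List.sum_replicate,
    smul_eq_mul]

/-- All `m` slots have `B + 1` bits, so the concatenation can be cut uniquely; the leading flag of a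
slot tells whether it is used. -/
theorem listCode_inj (hB : ∀ x, p x → (c x).length = B)
    (hc : ∀ x y, p x → p y → c x = c y → x = y) {l l' : List α} (hl : ∀ x ∈ l, p x)
    (hl' : ∀ x ∈ l', p x) (hm : l.length ≤ m) (hm' : l'.length ≤ m)
    (h : listCode B c m l = listCode B c m l') : l = l' := by
  have h1 := List.eq_iff_flatten_eq.2 ⟨h, (map_length_optionCode hB hl).trans
    (map_length_optionCode hB hl').symm⟩
  refine List.ext_getElem? fun i => ?_
  rcases Nat.lt_or_ge i m with hi | hi
  · exact optionCode_inj hc (fun x hx => hl x (List.mem_of_getElem? hx))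
      (fun x hx => hl' x (List.mem_of_getElem? hx))
      (congrFun (List.ofFn_injective h1) ⟨i, hi⟩)
  · rw [List.getElem?_eq_none (by omega), List.getElem?_eq_none (by omega)]

/-- Finite sets of at most `F` lists of at most `m` numbers of at most `w` bits. -/
def IsMessage (w m F : ℕ) (X : Finset (List ℕ)) : Prop :=
  X.card ≤ F ∧ ∀ l ∈ X, l.length ≤ m ∧ ∀ x ∈ l, x < 2 ^ w

/-- The bit string that represents a finite set of lists of numbers. -/
noncomputable def messageCode (w m F : ℕ) (X : Finset (List ℕ)) : List Bool :=
  listCode (m * (w + 1)) (listCode w (natCode w) m) F X.toList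

theorem length_messageCode {w m F : ℕ} {X : Finset (List ℕ)} (hX : IsMessage w m F X) :
    (messageCode w m F X).length = F * (m * (w + 1) + 1) :=
  length_listCode (p := fun l : List ℕ => l.length ≤ m ∧ ∀ x ∈ l, x < 2 ^ w)
    (fun _ hl => length_listCode (fun x _ => length_natCode w x) hl.2)
    fun l hl => hX.2 l (mem_toList.1 hl)

theorem messageCode_injOn (w m F : ℕ) :
    Set.InjOn (messageCode w m F) {X | IsMessage w m F X} := by
  intro X hX Y hY h
  have := listCode_inj (p := fun l : List ℕ => l.length ≤ m ∧ ∀ x ∈ l, x < 2 ^ w)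
    (fun _ hl => length_listCode (fun x _ => length_natCode w x) hl.2)
    (fun l l' hl hl' h => listCode_inj (fun x _ => length_natCode w x)
      (fun x y hx hy => natCode_inj hx hy) hl.2 hl'.2 hl.1 hl'.1 h)
    (fun l hl => hX.2 l (mem_toList.1 hl)) (fun l hl => hY.2 l (mem_toList.1 hl))
    ((length_toList X).trans_le hX.1) ((length_toList Y).trans_le hY.1) h
  rw [← toList_toFinset X, ← toList_toFinset Y, this]

end Codes

/-! ### Routing tables -/

open Classical in
/-- One list of `C` for every last entry of a list of `C`. -/
noncomputable def pick (C : Finset (List ℕ)) : Finset (List ℕ) :=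
  (C.image List.getLast?).image fun o => Classical.epsilon fun l => l ∈ C ∧ l.getLast? = o

/-- One round of the construction of routing tables: `a` is the own label, `T` the current table,
and `R` consists of the entries of all neighbors. -/
noncomputable def routeStep (a : ℕ) (T R : Finset (List ℕ)) : Finset (List ℕ) :=
  -- The three conditions keep the list a path, keep its target minimal, and exclude targets that
  -- already have an entry.
  T ∪ pick ((R.filter fun l => a ∉ l ∧ (∀ b ∈ l.getLast?, b ≤ a) ∧
    ∀ l' ∈ T, l'.getLast? ≠ l.getLast?).image (List.cons a))

theorem pick_spec {C : Finset (List ℕ)} {l : List ℕ} (hl : l ∈ pick C) :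
    ∃ l' ∈ C, l = Classical.epsilon fun m => m ∈ C ∧ m.getLast? = l'.getLast? := by
  simp only [pick, mem_image, exists_exists_and_eq_and] at hl
  obtain ⟨l', hl', rfl⟩ := hl
  exact ⟨l', hl', rfl⟩

theorem epsilon_getLast_spec {C : Finset (List ℕ)} {l : List ℕ} (hl : l ∈ C) :
    (Classical.epsilon fun m => m ∈ C ∧ m.getLast? = l.getLast?) ∈ C ∧
    (Classical.epsilon fun m => m ∈ C ∧ m.getLast? = l.getLast?).getLast? = l.getLast? :=
  Classical.epsilon_spec (p := fun m => m ∈ C ∧ m.getLast? = l.getLast?) ⟨l, hl, rfl⟩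

theorem pick_subset (C : Finset (List ℕ)) : pick C ⊆ C := by
  intro l hl
  obtain ⟨l', hl', rfl⟩ := pick_spec hl
  exact (epsilon_getLast_spec hl').1

theorem injOn_getLast_pick (C : Finset (List ℕ)) :
    Set.InjOn List.getLast? (pick C : Set (List ℕ)) := by
  intro l hl m hm h
  obtain ⟨l', hl', rfl⟩ := pick_spec (mem_coe.1 hl)
  obtain ⟨m', hm', rfl⟩ := pick_spec (mem_coe.1 hm)
  rw [(epsilon_getLast_spec hl').2, (epsilon_getLast_spec hm').2] at h
  rw [h]

theorem exists_mem_pick {C : Finset (List ℕ)} {l : List ℕ} (hl : l ∈ C) :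
    ∃ l' ∈ pick C, l'.getLast? = l.getLast? := by
  refine ⟨_, ?_, (epsilon_getLast_spec hl).2⟩
  simp only [pick, mem_image, exists_exists_and_eq_and]
  exact ⟨l, hl, rfl⟩

/-- The table `R` has exactly one entry for every `u ∈ WReach_d[G, L, v]` and no other entries,
namely the list of labels along a path that shows `u` to be weakly reachable. -/
structure IsRouteTable {V : Type u} (G : SimpleGraph V) (L : LinearOrder V) (lab : V → ℕ) (d : ℕ)
    (v : V) (R : Finset (List ℕ)) : Prop where
  sound : ∀ l ∈ R, ∃ u, ∃ p : G.Walk v u, p.IsPath ∧ p.length ≤ d ∧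
    (∀ x ∈ p.support, L.le u x) ∧ l = p.support.map lab
  complete : ∀ u ∈ wReach G L d v, ∃ l ∈ R, l.getLast? = some (lab u)
  injOn : Set.InjOn List.getLast? (R : Set (List ℕ))

section Routes

variable {V : Type u} {G : SimpleGraph V} {L : LinearOrder V} {lab : V → ℕ} {d : ℕ} {v : V}

theorem getLast_map_support {u : V} (p : G.Walk v u) :
    (p.support.map lab).getLast? = some (lab u) := by
  rw [List.getLast?_map, List.getLast?_eq_some_getLast p.support_ne_nil,
    SimpleGraph.Walk.getLast_support]
  rfl

theorem isRouteTable_zero : IsRouteTable G L lab 0 v {[lab v]} where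
  sound := by
    intro l hl
    rw [mem_singleton] at hl
    refine ⟨v, .nil, by simp, le_rfl, fun x hx => ?_, by simp [hl]⟩
    rw [SimpleGraph.Walk.support_nil, List.mem_singleton] at hx
    exact hx ▸ L.le_refl _
  complete := by
    intro u hu
    rw [mem_wReach_zero.1 hu]
    exact ⟨_, mem_singleton_self _, rfl⟩
  injOn := by simp

theorem IsRouteTable.step [Fintype V] {R : V → Finset (List ℕ)} {A : Finset (List ℕ)}
    (hlab : Function.Injective lab) (hL : ∀ u v, L.le u v ↔ lab u ≤ lab v)
    (hR : ∀ v, IsRouteTable G L lab d v (R v))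
    (hA : ∀ l, l ∈ A ↔ ∃ w, G.Adj v w ∧ l ∈ R w) :
    IsRouteTable G L lab (d + 1) v (routeStep (lab v) (R v) A) where
  sound := by
    intro l hl
    rcases mem_union.1 hl with hl | hl
    · obtain ⟨u, p, h1, h2, h3⟩ := (hR v).sound l hl
      exact ⟨u, p, h1, by omega, h3⟩
    · have := pick_subset _ hl
      simp only [mem_image, mem_filter, hA] at this
      obtain ⟨l, ⟨⟨w, hvw, hw⟩, hv, hle, -⟩, rfl⟩ := this
      obtain ⟨u, q, h1, h2, h3, rfl⟩ := (hR w).sound l hw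
      refine ⟨u, .cons hvw q, ?_, ?_, ?_, by simp⟩
      · rw [SimpleGraph.Walk.cons_isPath_iff]
        exact ⟨h1, fun h => hv (List.mem_map_of_mem h)⟩
      · rw [SimpleGraph.Walk.length_cons]
        omega
      · intro x hx
        rw [SimpleGraph.Walk.support_cons, List.mem_cons] at hx
        rcases hx with rfl | hx
        · exact (hL _ _).2 (hle _ (getLast_map_support q))
        · exact h3 x hx
  complete := by
    intro u hu
    by_cases hex : ∃ l ∈ R v, l.getLast? = some (lab u)
    · obtain ⟨l, hl, h⟩ := hex
      exact ⟨l, mem_union_left _ hl, h⟩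
    have hnot : u ∉ wReach G L d v := fun h => hex ((hR v).complete u h)
    obtain ⟨p, -, hl, hs⟩ := hu
    cases p with
    | nil => exact absurd (wReach_mono (Nat.zero_le _) (mem_wReach_zero.2 rfl)) hnot
    | @cons _ w _ h q =>
      rw [SimpleGraph.Walk.length_cons] at hl
      obtain ⟨l, hlw, hlu⟩ := (hR w).complete u
        (mem_wReach_of_walk q (by omega) fun x hx => hs x (by simp [hx]))
      have hmem : lab v :: l ∈ (A.filter fun l => lab v ∉ l ∧ (∀ b ∈ l.getLast?, b ≤ lab v) ∧
          ∀ l' ∈ R v, l'.getLast? ≠ l.getLast?).image (List.cons (lab v)) := by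
        refine mem_image_of_mem _ (mem_filter.2 ⟨(hA l).2 ⟨w, h, hlw⟩, fun hvl => ?_, ?_, ?_⟩)
        -- Rejecting lists through `v` loses nothing: the part of such a path after `v` would make
        -- `u` weakly reachable from `v` within `d`, so the table would already have an entry for
        -- `u`.
        · obtain ⟨u', q', -, hq', hs', rfl⟩ := (hR w).sound l hlw
          rw [getLast_map_support] at hlu
          obtain rfl := hlab (Option.some.inj hlu)
          rw [List.mem_map_of_injective hlab] at hvl
          exact hnot (mem_wReach_of_mem_support q' hq' hs' hvl)
        · intro b hb
          rw [hlu, Option.mem_some_iff] at hb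
          exact hb ▸ (hL _ _).1 (hs v (by simp))
        · intro l' hl' h'
          exact hex ⟨l', hl', h'.trans hlu⟩
      obtain ⟨l', hl', h'⟩ := exists_mem_pick hmem
      refine ⟨l', mem_union_right _ hl', h'.trans ?_⟩
      rw [List.getLast?_cons, hlu]
      rfl
  injOn := by
    have hne : ∀ l ∈ R v, ∀ m ∈ pick ((A.filter fun l => lab v ∉ l ∧
        (∀ b ∈ l.getLast?, b ≤ lab v) ∧ ∀ l' ∈ R v, l'.getLast? ≠ l.getLast?).image
        (List.cons (lab v))), l.getLast? ≠ m.getLast? := by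
      intro l hl m hm
      have := pick_subset _ hm
      simp only [mem_image, mem_filter, hA] at this
      obtain ⟨m, ⟨⟨w, -, hw⟩, -, -, hm'⟩, rfl⟩ := this
      obtain ⟨u, q, -, -, -, rfl⟩ := (hR w).sound m hw
      have := hm' l hl
      rw [getLast_map_support] at this
      rwa [List.getLast?_cons, getLast_map_support]
    intro l hl m hm h
    rcases mem_union.1 (mem_coe.1 hl) with hl | hl <;>
      rcases mem_union.1 (mem_coe.1 hm) with hm | hm
    · exact (hR v).injOn hl hm h
    · exact absurd h (hne l hl m hm)
    · exact absurd h.symm (hne m hm l hl)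
    · exact injOn_getLast_pick _ hl hm h

theorem IsRouteTable.card_le {R : Finset (List ℕ)} {W : Finset V}
    (hR : IsRouteTable G L lab d v R) (hW : wReach G L d v ⊆ W) : R.card ≤ W.card := by
  classical
  calc R.card = (R.image List.getLast?).card := (card_image_of_injOn hR.injOn).symm
    _ ≤ (W.image fun u => some (lab u)).card := by
      refine card_le_card fun o ho => ?_
      obtain ⟨l, hl, rfl⟩ := mem_image.1 ho
      obtain ⟨u, p, h1, h2, h3, rfl⟩ := hR.sound l hl
      exact mem_image.2 ⟨u, mem_coe.1 (hW ⟨p, h1, h2, h3⟩), (getLast_map_support p).symm⟩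
    _ ≤ W.card := card_image_le

/-- Labels carry the identifiers as residues, so a table of labels already determines the required
output. -/
theorem routesCorrect_of_isRouteTable {L : LinearOrder V} {lab ident : V → ℕ}
    {m r : ℕ} {R : V → Finset (List ℕ)} {out : V → CoverOutput} (hlab : ∀ v, lab v % m = ident v)
    (hid : Function.Injective ident)
    (hR : ∀ v, IsRouteTable G L lab (2 * r) v (R v))
    (hout : ∀ v, (out v).routes =
      (R v).image fun l => (l.getLast?.getD 0 % m, l.map fun x => x % m)) :
    RoutesCorrect G ident L r out := by
  have hmap : ∀ {u v : V} (p : G.Walk v u),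
      (((p.support.map lab).getLast?.getD 0 % m, (p.support.map lab).map fun x => x % m) :
        ℕ × List ℕ) = (ident u, p.support.map ident) := by
    intro u v p
    rw [getLast_map_support, Option.getD_some, hlab, List.map_map]
    congr 2
    funext x
    exact hlab x
  intro v
  rw [hout v]
  constructor
  · intro u hu
    obtain ⟨l, hl, hlu⟩ := (hR v).complete u hu
    refine ⟨l.map fun x => x % m, ?_, fun l' hl' => ?_⟩
    · exact mem_image.2 ⟨l, hl, by rw [hlu, Option.getD_some, hlab]⟩
    · obtain ⟨l₁, hl₁, h⟩ := mem_image.1 hl'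
      obtain ⟨u₁, p, -, -, -, rfl⟩ := (hR v).sound l₁ hl₁
      have h' := h
      rw [hmap p] at h'
      obtain rfl := hid (Prod.ext_iff.1 h').1
      have := (hR v).injOn hl hl₁ (hlu.trans (getLast_map_support p).symm)
      rw [this]
      exact (Prod.ext_iff.1 h).2.symm
  · intro e he
    obtain ⟨l, hl, rfl⟩ := mem_image.1 he
    obtain ⟨u, p, h1, h2, h3, rfl⟩ := (hR v).sound l hl
    exact ⟨u, ⟨p, h1, h2, h3⟩, p, h1, h2, fun x hx => mem_wReach_of_mem_support p h2 h3 hx,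
      hmap p⟩

theorem IsRouteTable.of_subsingleton [Subsingleton V] {L : LinearOrder V} {lab : V → ℕ} {v : V}
    {R : Finset (List ℕ)} (h : IsRouteTable G L lab 0 v R) (d : ℕ) :
    IsRouteTable G L lab d v R where
  sound := fun l hl => by
    obtain ⟨u, p, h1, h2, h3⟩ := h.sound l hl
    exact ⟨u, p, h1, by omega, h3⟩
  complete := fun u hu => h.complete u (wReach_eq_of_subsingleton d 0 v ▸ hu)
  injOn := h.injOn

end Routes

/-! ### The algorithm -/

/-- The state of a vertex: its input, the number of completed rounds, the number of phases of
peeling that it survived, whether it has found too many exits in the current phase, the hits found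
in the current phase, and its routing table. -/
structure NodeState where
  input : LocalInput
  clock : ℕ
  lay : ℕ
  heavy : Bool
  tab : Finset (List ℕ)
  routes : Finset (List ℕ)

/-- The label of a vertex that survives `l` phases; here `w` is the length of identifiers. -/
def vertexLabel (w l id : ℕ) : ℕ := (2 * w - l) * 2 ^ w + id

namespace NodeState

/-- The length of a phase. -/
def period (s : NodeState) : ℕ := 2 * s.input.param

/-- The length of identifiers. -/
def width (s : NodeState) : ℕ := Nat.clog 2 s.input.order

/-- The current label. -/
def label (s : NodeState) : ℕ := vertexLabel s.width s.lay s.input.ownId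

/-- The set that a vertex broadcasts. -/
def message (s : NodeState) : Finset (List ℕ) :=
  if s.clock < 2 * s.width * s.period then s.tab else s.routes

/-- One round of peeling, where `R` is the union of the received sets. -/
def peelStep (g : ℕ → ℕ) (s : NodeState) (R : Finset (List ℕ)) : NodeState :=
  let p := s.clock / s.period
  let d := s.clock % s.period
  -- In round `d` of a phase the neighbors broadcast their hits within distance `d`, so `R`
  -- represents the exits for `d`.
  let heavy := s.heavy || decide (exitBound g s.period d < R.card)
  if d + 1 < s.period then
    { s with
      clock := s.clock + 1
      heavy := heavy
      tab := if s.lay = p then {[s.input.ownId]} else R }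
  else
    let lay := if s.lay = p ∧ heavy then p + 1 else s.lay
    { s with
      clock := s.clock + 1
      lay := lay
      heavy := false
      tab := if lay = p + 1 then {[s.input.ownId]} else ∅
      -- The layer may have changed, so the table for distance `0` is set anew; only the last phase
      -- matters.
      routes := {[vertexLabel s.width lay s.input.ownId]} }

/-- One round, where `R` is the union of the received sets. -/
noncomputable def step (g : ℕ → ℕ) (s : NodeState) (R : Finset (List ℕ)) : NodeState :=
  if s.clock < 2 * s.width * s.period then peelStep g s R
  else { s with clock := s.clock + 1, routes := routeStep s.label s.routes R }

end NodeState

/-- A bound on the size of the sets that are broadcast. -/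
def messageBound (g : ℕ → ℕ) (k : ℕ) : ℕ := hitBound g k k + reachBound g k k

/-- The bit string for a set that is broadcast in a network of order `n`. -/
noncomputable def encodeMessage (g : ℕ → ℕ) (r n : ℕ) (X : Finset (List ℕ)) : List Bool :=
  messageCode (3 * Nat.clog 2 n) (2 * r + 1) (messageBound g (2 * r)) X

/-- The sets that may be broadcast in a network of order `n`. -/
def messageSet (g : ℕ → ℕ) (r n : ℕ) : Set (Finset (List ℕ)) :=
  {X | IsMessage (3 * Nat.clog 2 n) (2 * r + 1) (messageBound g (2 * r)) X}

/-- The set represented by a bit string. -/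
noncomputable def decodeMessage (g : ℕ → ℕ) (r n : ℕ) (m : List Bool) : Finset (List ℕ) :=
  Function.invFunOn (encodeMessage g r n) (messageSet g r n) m

theorem decode_encode {g : ℕ → ℕ} {r n : ℕ} {X : Finset (List ℕ)} (hX : X ∈ messageSet g r n) :
    decodeMessage g r n (encodeMessage g r n X) = X :=
  (messageCode_injOn _ _ _).leftInvOn_invFunOn hX

/-- The algorithm that computes a sparse neighborhood cover in graphs whose depth-`d` minors have
average degree at most `g d`. -/
noncomputable def coverAlgorithm (g : ℕ → ℕ) : BroadcastAlgorithm CoverOutput where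
  State := NodeState
  init := fun inp =>
    { input := inp
      clock := 0
      lay := 0
      heavy := false
      tab := {[inp.ownId]}
      routes := {[vertexLabel (Nat.clog 2 inp.order) 0 inp.ownId]} }
  send := fun s => encodeMessage g s.input.param s.input.order s.message
  receive := fun s R =>
    s.step g (R.biUnion fun m => decodeMessage g s.input.param s.input.order m.2)
  output := fun s =>
    { label := s.label
      routes := s.routes.image fun l =>
        (l.getLast?.getD 0 % 2 ^ s.width, l.map fun x => x % 2 ^ s.width) }
  -- The minimum drops the routing rounds when `⌈log₂ n⌉ = 0`, where the claimed bound allows no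
  -- round at all.
  rounds := fun r n => 2 * r * (2 * Nat.clog 2 n + min 1 (Nat.clog 2 n))

/-! ### Arithmetic of the labels -/

section Labels

variable {w l l' i i' : ℕ}

theorem vertexLabel_mod (hi : i < 2 ^ w) : vertexLabel w l i % 2 ^ w = i := by
  rw [vertexLabel, Nat.mul_add_mod', Nat.mod_eq_of_lt hi]

theorem vertexLabel_lt (hi : i < 2 ^ w) : vertexLabel w l i < 2 ^ (3 * w) := by
  have h1 : 2 * w < 2 ^ (2 * w) := Nat.lt_two_pow_self
  have h2 : (2 * w - l) * 2 ^ w ≤ 2 * w * 2 ^ w := Nat.mul_le_mul_right _ (Nat.sub_le _ _)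
  have h3 : (2 * w + 1) * 2 ^ w ≤ 2 ^ (2 * w) * 2 ^ w := Nat.mul_le_mul_right _ h1
  rw [← pow_add, show 2 * w + w = 3 * w by ring] at h3
  rw [vertexLabel]
  linarith

/-- One layer shifts the label by `2 ^ w`, more than identifiers can compensate. -/
theorem le_of_vertexLabel_le (hl : l ≤ 2 * w) (hi : i < 2 ^ w)
    (h : vertexLabel w l' i' ≤ vertexLabel w l i) : l ≤ l' := by
  by_contra! hlt
  have h1 : (2 * w - l + 1) * 2 ^ w ≤ (2 * w - l') * 2 ^ w :=
    Nat.mul_le_mul_right _ (by omega)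
  rw [vertexLabel, vertexLabel] at h
  linarith

end Labels

/-! ### Correctness -/

/-! ### Simulation of the peeling rounds -/

section Execution

variable {V : Type u} [Fintype V] (g : ℕ → ℕ) (G : SimpleGraph V) (ident : V → ℕ) (r : ℕ)

open Classical in
/-- The initial knowledge of `v`. -/
noncomputable def localInput (v : V) : LocalInput where
  param := r
  order := Fintype.card V
  ownId := ident v
  nbrIds := (G.neighborFinset v).image ident

open Classical in
/-- The state of `v` after `t` rounds of peeling. -/
noncomputable def peelState (t : ℕ) (v : V) : NodeState where
  input := localInput G ident r v
  clock := t
  lay := layer G g (2 * r) (t / (2 * r)) v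
  heavy := decide (∃ d < t % (2 * r), exitBound g (2 * r) d <
    (exits G (remaining G g (2 * r) (t / (2 * r))) d v).card)
  tab := (hits G (remaining G g (2 * r) (t / (2 * r))) (t % (2 * r)) v).image fun u => [ident u]
  routes := {[vertexLabel (Nat.clog 2 (Fintype.card V))
    (layer G g (2 * r) (t / (2 * r)) v) (ident v)]}

variable {g G ident r}

open Classical in
-- As long as all broadcast sets are admissible, decoding inverts encoding, and a round acts as if
-- the sets themselves were exchanged.
theorem stateAfter_succ {s : V → NodeState} {t : ℕ}
    (hs : ∀ v, (coverAlgorithm g).stateAfter G ident r t v = s v)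
    (hin : ∀ v, (s v).input = localInput G ident r v)
    (hmsg : ∀ v, (s v).message ∈ messageSet g r (Fintype.card V)) (v : V) :
    (coverAlgorithm g).stateAfter G ident r (t + 1) v =
      (s v).step g ((G.neighborFinset v).biUnion fun w => (s w).message) := by
  rw [BroadcastAlgorithm.stateAfter]
  simp only [hs]
  change (s v).step g _ = _
  congr 1
  rw [hin v]
  ext l
  simp only [mem_biUnion, mem_image, exists_exists_and_eq_and]
  refine exists_congr fun w => and_congr_right fun _ => ?_
  change l ∈ decodeMessage g r (Fintype.card V)
    (encodeMessage g (s w).input.param (s w).input.order (s w).message) ↔ _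
  rw [hin w]
  change l ∈ decodeMessage g r (Fintype.card V)
    (encodeMessage g r (Fintype.card V) (s w).message) ↔ _
  rw [decode_encode (hmsg w)]

theorem stateAfter_zero (v : V) :
    (coverAlgorithm g).stateAfter G ident r 0 v = peelState g G ident r 0 v := by
  simp [BroadcastAlgorithm.stateAfter, coverAlgorithm, peelState, layer, remaining,
    hits_of_mem, localInput]

theorem message_peelState {t : ℕ} (ht : t < 2 * Nat.clog 2 (Fintype.card V) * (2 * r)) (v : V) :
    (peelState g G ident r t v).message = (peelState g G ident r t v).tab :=
  if_pos ht

theorem message_peelState_mem (hid : IsIdAssignment ident) {t : ℕ}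
    (ht : t < 2 * Nat.clog 2 (Fintype.card V) * (2 * r)) (v : V) :
    (peelState g G ident r t v).message ∈ messageSet g r (Fintype.card V) := by
  classical
  have hk : 0 < 2 * r := Nat.pos_of_ne_zero fun h => by simp [h] at ht
  rw [message_peelState ht]
  refine ⟨?_, fun l hl => ?_⟩
  · have hd : t % (2 * r) ≤ 2 * r := (Nat.mod_lt _ hk).le
    calc _ ≤ _ := card_image_le
      _ ≤ _ := card_hits_remaining_le hd
      _ ≤ _ := hitBound_mono hk hd
      _ ≤ _ := Nat.le_add_right _ _
  · simp only [peelState, mem_image] at hl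
    obtain ⟨u, -, rfl⟩ := hl
    refine ⟨by simp, fun x hx => ?_⟩
    rw [List.mem_singleton] at hx
    rw [hx]
    exact (hid.2 u).trans_le (Nat.pow_le_pow_right (by norm_num) (by omega))

open Classical in
theorem step_peelState (hid : IsIdAssignment ident) {t : ℕ}
    (ht : t < 2 * Nat.clog 2 (Fintype.card V) * (2 * r)) (v : V) :
    (peelState g G ident r t v).step g
      ((G.neighborFinset v).biUnion fun w => (peelState g G ident r t w).message) =
      peelState g G ident r (t + 1) v := by
  have hk : 0 < 2 * r := Nat.pos_of_ne_zero fun h => by simp [h] at ht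
  have hR : ((G.neighborFinset v).biUnion fun w => (peelState g G ident r t w).message) =
      (exits G (remaining G g (2 * r) (t / (2 * r))) (t % (2 * r)) v).image
        fun u => [ident u] := by
    simp only [message_peelState ht]
    rw [exits, biUnion_image]
    rfl
  have hcard : ((exits G (remaining G g (2 * r) (t / (2 * r))) (t % (2 * r)) v).image
      fun u => [ident u]).card =
      (exits G (remaining G g (2 * r) (t / (2 * r))) (t % (2 * r)) v).card :=
    card_image_of_injective _ fun a b h => hid.1 (List.cons.inj h).1
  rw [hR, NodeState.step]
  refine (if_pos ht).trans ?_
  rw [NodeState.peelStep]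
  have hper : (peelState g G ident r t v).period = 2 * r := rfl
  have hwid : (peelState g G ident r t v).width = Nat.clog 2 (Fintype.card V) := rfl
  have hheavy : ((peelState g G ident r t v).heavy || decide (exitBound g (2 * r) (t % (2 * r)) <
      (exits G (remaining G g (2 * r) (t / (2 * r))) (t % (2 * r)) v).card)) =
      decide (∃ d < t % (2 * r) + 1, exitBound g (2 * r) d <
        (exits G (remaining G g (2 * r) (t / (2 * r))) d v).card) := by
    simp only [peelState, Nat.exists_lt_succ_right, Bool.decide_or]
  have hclock : (peelState g G ident r t v).clock = t := rfl
  have hlay : (peelState g G ident r t v).lay = layer G g (2 * r) (t / (2 * r)) v := rfl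
  have hid' : (peelState g G ident r t v).input.ownId = ident v := rfl
  simp only [hper, hclock, hcard, hheavy, hlay, hid', hwid]
  have hlt := Nat.mod_lt t hk
  have hdm := Nat.div_add_mod t (2 * r)
  by_cases h1 : t % (2 * r) + 1 < 2 * r
  · have ht1 : t + 1 = t % (2 * r) + 1 + 2 * r * (t / (2 * r)) := by omega
    have hdiv : (t + 1) / (2 * r) = t / (2 * r) := by
      conv_lhs => rw [ht1, Nat.add_mul_div_left _ _ hk, Nat.div_eq_of_lt h1, Nat.zero_add]
    have hmod : (t + 1) % (2 * r) = t % (2 * r) + 1 := by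
      conv_lhs => rw [ht1, Nat.add_mul_mod_self_left, Nat.mod_eq_of_lt h1]
    rw [if_pos h1]
    simp only [peelState, hdiv, hmod, NodeState.mk.injEq, true_and, and_true]
    split_ifs with h2
    · rw [hits_of_mem (mem_remaining_iff_layer_eq.2 h2), image_singleton]
    · rw [hits_succ_of_notMem fun h => h2 (mem_remaining_iff_layer_eq.1 h)]
  · have hd : t % (2 * r) + 1 = 2 * r := by omega
    have ht1 : t + 1 = 2 * r * (t / (2 * r) + 1) := by
      rw [Nat.mul_add, Nat.mul_one]
      omega
    have hdiv : (t + 1) / (2 * r) = t / (2 * r) + 1 := by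
      conv_lhs => rw [ht1, Nat.mul_div_cancel_left _ hk]
    have hmod : (t + 1) % (2 * r) = 0 := by
      rw [ht1, Nat.mul_mod_right]
    rw [if_neg h1]
    -- After the last round of a phase all `d < 2r` have been tested, so the update is the recursion
    -- of `layer`.
    have hl : (if layer G g (2 * r) (t / (2 * r)) v = t / (2 * r) ∧
        decide (∃ d < t % (2 * r) + 1, exitBound g (2 * r) d <
          (exits G (remaining G g (2 * r) (t / (2 * r))) d v).card) = true
        then t / (2 * r) + 1 else layer G g (2 * r) (t / (2 * r)) v) =
        layer G g (2 * r) (t / (2 * r) + 1) v := by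
      simp only [layer, remaining, mem_filter, mem_remaining_iff_layer_eq, hd, decide_eq_true_eq]
    simp only [peelState, hdiv, hmod, hl, NodeState.mk.injEq, true_and]
    refine ⟨by simp, ?_, trivial⟩
    split_ifs with h2
    · rw [hits_of_mem (mem_remaining_iff_layer_eq.2 h2), image_singleton]
    · rw [hits_zero_of_notMem fun h => h2 (mem_remaining_iff_layer_eq.1 h), image_empty]

theorem stateAfter_eq_peelState (hid : IsIdAssignment ident) {t : ℕ}
    (ht : t ≤ 2 * Nat.clog 2 (Fintype.card V) * (2 * r)) (v : V) :
    (coverAlgorithm g).stateAfter G ident r t v = peelState g G ident r t v := by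
  classical
  induction t generalizing v with
  | zero => exact stateAfter_zero v
  | succ t ih =>
    rw [stateAfter_succ (fun v => ih (by omega) v) (fun _ => rfl)
      (message_peelState_mem hid ht) v, step_peelState hid ht]

end Execution

/-! ### Simulation of the routing rounds -/

section Routing

variable {V : Type u} [Fintype V] (g : ℕ → ℕ) (G : SimpleGraph V) (ident : V → ℕ) (r : ℕ)

/-- The layer of a vertex after all phases of peeling. -/
noncomputable def finalLayer (v : V) : ℕ :=
  layer G g (2 * r) (2 * Nat.clog 2 (Fintype.card V) * (2 * r) / (2 * r)) v

/-- The label of a vertex after all phases of peeling. -/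
noncomputable def finalLabel (v : V) : ℕ :=
  vertexLabel (Nat.clog 2 (Fintype.card V)) (finalLayer g G r v) (ident v)

/-- The state of `v` after `d` rounds of routing, with the routing table `R`. -/
noncomputable def routeState (d : ℕ) (R : Finset (List ℕ)) (v : V) : NodeState :=
  { peelState g G ident r (2 * Nat.clog 2 (Fintype.card V) * (2 * r)) v with
    clock := 2 * Nat.clog 2 (Fintype.card V) * (2 * r) + d
    routes := R }

variable {g G ident r}

theorem finalLabel_mod (hid : IsIdAssignment ident) (v : V) :
    finalLabel g G ident r v % 2 ^ Nat.clog 2 (Fintype.card V) = ident v :=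
  vertexLabel_mod (hid.2 v)

theorem finalLabel_injective (hid : IsIdAssignment ident) :
    Function.Injective (finalLabel g G ident r) := fun u v h => hid.1 <| by
  rw [← finalLabel_mod (g := g) (G := G) (r := r) hid u, h, finalLabel_mod hid]

theorem card_wReach_le {L : LinearOrder V} (hid : IsIdAssignment ident)
    (hg : ∀ (d : ℕ) (W : Type u) [Fintype W] (H : SimpleGraph W), IsDepthMinor d H G →
      averageDegree H ≤ g d)
    (hL : ∀ u v, L.le u v ↔ finalLabel g G ident r u ≤ finalLabel g G ident r v)
    (hr : 0 < r) (hw : 0 < Nat.clog 2 (Fintype.card V)) {d : ℕ} (hd : d ≤ 2 * r) (v : V) :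
    wReach G L d v ⊆ layerReach G (finalLayer g G r) d v ∧
      (layerReach G (finalLayer g G r) d v).card ≤ reachBound g (2 * r) d := by
  have hdiv : 2 * Nat.clog 2 (Fintype.card V) * (2 * r) / (2 * r) =
      2 * Nat.clog 2 (Fintype.card V) := Nat.mul_div_cancel _ (by omega)
  constructor
  · rintro u ⟨p, -, hl, hs⟩
    simp only [layerReach, coe_filter, mem_univ, true_and]
    refine ⟨p, hl, fun x hx => le_of_vertexLabel_le ?_ (hid.2 x) ((hL u x).1 (hs x hx))⟩
    exact layer_le.trans_eq hdiv
  · refine card_layerReach_le (remaining_eq_empty (by omega) hg ?_) hd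
    rw [hdiv]
    calc Fintype.card V ≤ 2 ^ Nat.clog 2 (Fintype.card V) := Nat.le_pow_clog (by norm_num) _
      -- Doubling the number of phases beyond `⌈log₂ n⌉` makes the inequality strict, as this
      -- logarithm is positive.
      _ < _ := Nat.pow_lt_pow_right (by norm_num) (by omega)

theorem message_routeState_mem {L : LinearOrder V} (hid : IsIdAssignment ident)
    (hg : ∀ (d : ℕ) (W : Type u) [Fintype W] (H : SimpleGraph W), IsDepthMinor d H G →
      averageDegree H ≤ g d)
    (hL : ∀ u v, L.le u v ↔ finalLabel g G ident r u ≤ finalLabel g G ident r v)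
    (hw : 0 < Nat.clog 2 (Fintype.card V)) {d : ℕ} (hd : d < 2 * r) {v : V}
    {R : Finset (List ℕ)} (hR : IsRouteTable G L (finalLabel g G ident r) d v R) :
    (routeState g G ident r d R v).message ∈ messageSet g r (Fintype.card V) := by
  have hmsg : (routeState g G ident r d R v).message = R :=
    if_neg (Nat.not_lt.2 (Nat.le_add_right _ _))
  rw [hmsg]
  obtain ⟨h1, h2⟩ := card_wReach_le hid hg hL (by omega) hw hd.le v
  refine ⟨?_, fun l hl => ?_⟩
  · calc R.card ≤ _ := hR.card_le h1
      _ ≤ _ := h2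
      _ ≤ _ := reachBound_mono (by omega) hd.le
      _ ≤ _ := Nat.le_add_left _ _
  · obtain ⟨u, p, -, hp, -, rfl⟩ := hR.sound l hl
    refine ⟨?_, fun x hx => ?_⟩
    · rw [List.length_map, SimpleGraph.Walk.length_support]
      omega
    · obtain ⟨y, -, rfl⟩ := List.mem_map.1 hx
      exact vertexLabel_lt (hid.2 y)

theorem exists_stateAfter_eq_routeState {L : LinearOrder V} (hid : IsIdAssignment ident)
    (hg : ∀ (d : ℕ) (W : Type u) [Fintype W] (H : SimpleGraph W), IsDepthMinor d H G →
      averageDegree H ≤ g d)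
    (hL : ∀ u v, L.le u v ↔ finalLabel g G ident r u ≤ finalLabel g G ident r v)
    {d : ℕ} (hd : d ≤ 2 * r) (hw : d = 0 ∨ 0 < Nat.clog 2 (Fintype.card V)) :
    ∃ R : V → Finset (List ℕ),
      (∀ v, IsRouteTable G L (finalLabel g G ident r) d v (R v)) ∧
      ∀ v, (coverAlgorithm g).stateAfter G ident r
        (2 * Nat.clog 2 (Fintype.card V) * (2 * r) + d) v = routeState g G ident r d (R v) v := by
  classical
  induction d with
  | zero => exact ⟨_, fun v => isRouteTable_zero, stateAfter_eq_peelState hid le_rfl⟩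
  | succ d ih =>
    obtain ⟨R, hR, hs⟩ := ih (by omega) (Or.inr (by omega))
    have hmsg : ∀ v, (routeState g G ident r d (R v) v).message = R v :=
      fun v => if_neg (Nat.not_lt.2 (Nat.le_add_right _ _))
    refine ⟨fun v => routeStep (finalLabel g G ident r v) (R v)
      ((G.neighborFinset v).biUnion R), fun v => ?_, fun v => ?_⟩
    · exact IsRouteTable.step (finalLabel_injective hid) hL hR fun l => by simp
    · rw [← Nat.add_assoc, stateAfter_succ hs (fun _ => rfl)
        (fun v => message_routeState_mem hid hg hL (by omega) (by omega) (hR v))]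
      simp only [hmsg]
      exact if_neg (Nat.not_lt.2 (Nat.le_add_right _ _))

end Routing

/-! ### Bounds on rounds and messages -/

section Output

variable {V : Type u} [Fintype V] {g : ℕ → ℕ} {G : SimpleGraph V} {ident : V → ℕ} {r : ℕ}

theorem rounds_coverAlgorithm_le (n : ℕ) :
    (coverAlgorithm g).rounds r n ≤ 6 * r ^ 2 * Nat.clog 2 n := by
  change 2 * r * (2 * Nat.clog 2 n + min 1 (Nat.clog 2 n)) ≤ _
  have h1 : min 1 (Nat.clog 2 n) ≤ Nat.clog 2 n := min_le_right _ _
  have h2 : r ≤ r ^ 2 := Nat.le_self_pow (by norm_num) r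
  calc _ ≤ 2 * r * (2 * Nat.clog 2 n + Nat.clog 2 n) := by gcongr
    _ = 6 * r * Nat.clog 2 n := by ring
    _ ≤ _ := by gcongr

theorem length_encodeMessage_le {n : ℕ} (hn : 0 < Nat.clog 2 n) {X : Finset (List ℕ)}
    (hX : X ∈ messageSet g r n) : (encodeMessage g r n X).length ≤
      messageBound g (2 * r) * ((2 * r + 1) * 4 + 1) * Nat.clog 2 n := by
  rw [encodeMessage, length_messageCode hX, mul_assoc]
  gcongr
  -- With `w = ⌈log₂ n⌉ ≥ 1` this is `(2r + 1)(3w + 1) + 1 ≤ ((2r + 1) * 4 + 1) w`.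
  nlinarith

theorem messagesAtMost_coverAlgorithm {L : LinearOrder V} (hid : IsIdAssignment ident)
    (hg : ∀ (d : ℕ) (W : Type u) [Fintype W] (H : SimpleGraph W), IsDepthMinor d H G →
      averageDegree H ≤ g d)
    (hL : ∀ u v, L.le u v ↔ finalLabel g G ident r u ≤ finalLabel g G ident r v) :
    (coverAlgorithm g).MessagesAtMost G ident r
      (messageBound g (2 * r) * ((2 * r + 1) * 4 + 1) * Nat.clog 2 (Fintype.card V)) := by
  intro t ht v
  change t < 2 * r * (2 * Nat.clog 2 (Fintype.card V) + min 1 (Nat.clog 2 (Fintype.card V))) at ht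
  have hw : 0 < Nat.clog 2 (Fintype.card V) := Nat.pos_of_ne_zero fun h => by simp [h] at ht
  rcases Nat.lt_or_ge t (2 * Nat.clog 2 (Fintype.card V) * (2 * r)) with h | h
  · rw [stateAfter_eq_peelState hid h.le]
    exact length_encodeMessage_le hw (message_peelState_mem hid h v)
  · obtain ⟨d, rfl⟩ := Nat.exists_eq_add_of_le h
    rw [min_eq_left (by omega : 1 ≤ Nat.clog 2 (Fintype.card V))] at ht
    have hd : d < 2 * r := by nlinarith
    obtain ⟨R, hR, hs⟩ := exists_stateAfter_eq_routeState hid hg hL hd.le (Or.inr hw)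
    rw [hs]
    exact length_encodeMessage_le hw (message_routeState_mem hid hg hL hw hd (hR v))

end Output

end SparseCover

/-! ### Assembly of the theorem -/

theorem mainTheorem2 (𝒞 : SparseCover.GraphClass.{u}) (h𝒞 : SparseCover.BoundedExpansion 𝒞) :
    ∃ (A : SparseCover.BroadcastAlgorithm SparseCover.CoverOutput)
      (K c : ℕ) (b f : ℕ → ℕ),
      ∀ (r : ℕ) (V : Type u) [Fintype V] (G : SimpleGraph V), 𝒞 G →
      ∀ ident : V → ℕ, SparseCover.IsIdAssignment ident →
        A.rounds r (Fintype.card V) ≤ K * r ^ 2 * Nat.clog 2 (Fintype.card V) ∧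
        A.MessagesAtMost G ident r (b r * Nat.clog 2 (Fintype.card V)) ∧
        ∃ L : LinearOrder V,
          SparseCover.LabelsRepresent (A.result G ident r) L
            (c * Nat.clog 2 (Fintype.card V)) ∧
          SparseCover.RoutesCorrect G ident L r (A.result G ident r) ∧
          SparseCover.IsNeighborhoodCover G r (Set.range (SparseCover.cluster G L r)) ∧
          SparseCover.CoverRadiusAtMost G (Set.range (SparseCover.cluster G L r)) (2 * r) ∧
          SparseCover.CoverDegreeAtMost (Set.range (SparseCover.cluster G L r)) (f r) := by
  obtain ⟨g, hg⟩ := h𝒞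
  -- At most `3⌈log₂ n⌉` blocks of `2r` rounds give `6`, using `r ≤ r²`; a label takes three times
  -- the bits of an identifier.
  refine ⟨SparseCover.coverAlgorithm g, 6, 3,
    fun r => SparseCover.messageBound g (2 * r) * ((2 * r + 1) * 4 + 1),
    fun r => SparseCover.reachBound g (2 * r) (2 * r), ?_⟩
  intro r V _ G hG ident hid
  have hgG : ∀ (d : ℕ) (W : Type u) [Fintype W] (H : SimpleGraph W),
      SparseCover.IsDepthMinor d H G → SparseCover.averageDegree H ≤ g d :=
    fun d W _ H => hg d V G hG W H
  let L : LinearOrder V := LinearOrder.lift' (SparseCover.finalLabel g G ident r)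
    (SparseCover.finalLabel_injective hid)
  have hL : ∀ u v, L.le u v ↔ SparseCover.finalLabel g G ident r u ≤
      SparseCover.finalLabel g G ident r v := fun _ _ => Iff.rfl
  have hres : ∃ R : V → Finset (List ℕ),
      (∀ v, SparseCover.IsRouteTable G L (SparseCover.finalLabel g G ident r) (2 * r) v (R v)) ∧
      ∃ d, ∀ v, (SparseCover.coverAlgorithm g).stateAfter G ident r
        ((SparseCover.coverAlgorithm g).rounds r (Fintype.card V)) v =
        SparseCover.routeState g G ident r d (R v) v := by
    -- With at most one vertex no round is run, and the initial table is already correct for every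
    -- distance.
    rcases Nat.eq_zero_or_pos (Nat.clog 2 (Fintype.card V)) with hw | hw
    · have : Subsingleton V := Fintype.card_le_one_iff_subsingleton.1 (by
        simpa [hw] using Nat.le_pow_clog (b := 2) (by norm_num) (Fintype.card V))
      obtain ⟨R, hR, hs⟩ := SparseCover.exists_stateAfter_eq_routeState hid hgG hL
        (Nat.zero_le _) (Or.inl rfl)
      refine ⟨R, fun v => (hR v).of_subsingleton _, 0, fun v => ?_⟩
      rw [← hs v]
      congr 1
      simp [SparseCover.coverAlgorithm, hw]
    · obtain ⟨R, hR, hs⟩ := SparseCover.exists_stateAfter_eq_routeState hid hgG hL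
        le_rfl (Or.inr hw)
      refine ⟨R, hR, 2 * r, fun v => ?_⟩
      rw [← hs v]
      congr 1
      simp only [SparseCover.coverAlgorithm]
      rw [min_eq_left (by omega)]
      ring
  obtain ⟨R, hR, d, hs⟩ := hres
  have hlabel : ∀ v, ((SparseCover.coverAlgorithm g).result G ident r v).label =
      SparseCover.finalLabel g G ident r v := fun v => by
    rw [SparseCover.BroadcastAlgorithm.result, hs]
    rfl
  refine ⟨SparseCover.rounds_coverAlgorithm_le _,
    SparseCover.messagesAtMost_coverAlgorithm hid hgG hL, L, ⟨fun v => ?_, fun u v => ?_⟩,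
    SparseCover.routesCorrect_of_isRouteTable (SparseCover.finalLabel_mod hid) hid.1 hR
      fun v => ?_,
    SparseCover.isNeighborhoodCover_cluster, SparseCover.coverRadiusAtMost_cluster,
    SparseCover.coverDegreeAtMost_cluster fun v => ?_⟩
  · rw [hlabel]
    exact SparseCover.vertexLabel_lt (hid.2 v)
  · rw [hlabel, hlabel]
    exact hL u v
  · rw [SparseCover.BroadcastAlgorithm.result, hs]
    rfl
  · have hzero : (SparseCover.wReach G L 0 v).encard ≤
        (SparseCover.reachBound g (2 * r) (2 * r) : ℕ∞) := by
      have : SparseCover.wReach G L 0 v = {v} :=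
        Set.ext fun _ => SparseCover.mem_wReach_zero
      rw [this, Set.encard_singleton]
      exact_mod_cast SparseCover.reachBound_pos _
    rcases Nat.eq_zero_or_pos r with rfl | hr
    · exact hzero
    rcases Nat.eq_zero_or_pos (Nat.clog 2 (Fintype.card V)) with hw | hw
    · have : Subsingleton V := Fintype.card_le_one_iff_subsingleton.1 (by
        simpa [hw] using Nat.le_pow_clog (b := 2) (by norm_num) (Fintype.card V))
      rwa [SparseCover.wReach_eq_of_subsingleton (2 * r) 0 v]
    · obtain ⟨h1, h2⟩ := SparseCover.card_wReach_le hid hgG hL hr hw le_rfl v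
      refine (Set.encard_le_encard h1).trans ?_
      rw [Set.encard_coe_eq_coe_finsetCard]
      exact_mod_cast h2
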